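/- Let $m,n\ge 0$ be integers. For $1\le i\le m+n$ put $\bar\imath=0$ if $i\le m$ and $\bar\imath=1$ if $i>m$, and let $\mathfrak{gl}_{m|n}$ be the complex Lie superalgebra with standard basis $E_{ij}$ ($1\le i,j\le m+n$), $\deg E_{ij}=\bar\imath+\bar\jmath$, and super-commutator $[E_{ij},E_{kl}]=\delta_{kj}E_{il}-\delta_{il}E_{kj}(-1)^{(\bar\imath+\bar\jmath)(\bar k+\bar l)}$. Let $\lambda=(\lambda_1,\dots,\lambda_m\,|\,\lambda_{m+1},\dots,\lambda_{m+n})$ be a covariant highest weight: all $\lambda_i$ are nonnegative integers, $\lambda_i\ge\lambda_{i+1}$ for all $i\in\{1,\dots,m+n-1\}$ with $i\ne m$, and (if $m\geq 1$) the number of nonzero components among $\lambda_{m+1},\dots,\lambda_{m+n}$ does not exceed $\lambda_m$. Let $L(\lambda)$ be the irreducible representation of $\mathfrak{gl}_{m|n}$ with highest weight $\lambda$ and highest vector $\zeta$, that is, $\zeta\neq0$, $E_{ij}\zeta=0$ for $1\le i<j\le m+n$ and $E_{ii}\zeta=\lambda_i\zeta$ for $1\le i\le m+n$. For $1\le i\le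 m$ put $h_i=E_{ii}-i+1$, and for $1\le i\le m<a\le m+n$ define the lowering operator $$z_{ai}=\sum_{i<i_1<\dots<i_s\le m}E_{i_1i}E_{i_2i_1}\cdots E_{i_si_{s-1}}E_{ai_s}\,(h_i-h_{j_1})\cdots(h_i-h_{j_r}),$$ where $s=0,1,\dots$ (the first factors being just $E_{ai}$ for $s=0$) and $\{j_1,\dots,j_r\}$ is the complement of $\{i_1,\dots,i_s\}$ in $\{i+1,\dots,m\}$. Let $\mu=(\mu_1,\dots,\mu_m)$ be a partition, i.e. $\mu_1\ge\dots\ge\mu_m\ge0$ are integers, such that $0\le\lambda_i-\mu_i\le n$ for all $i=1,\dots,m$. Put $$\zeta_\mu=\prod_{j=1}^m\bigl(z_{m+\lambda_j-\mu_j,\,j}\cdots z_{m+2,\,j}\,z_{m+1,\,j}\bigr)\,\zeta,$$ the product being taken in increasing order of $j$ from left to right. Then $\zeta_\mu$ belongs to the multiplicity space $$L(\lambda)^+_\mu=\{\eta\in L(\lambda)\mid E_{ij}\eta=0\ (1\le i<j\le m),\ E_{ii}\eta=\mu_i\eta\ (1\le i\le m)\},$$ and $\zeta_\mu\ne0$.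 -/

import Mathlib

namespace GLSuper

/-- Index set `{1, …, m + n}` of `gl_{m|n}`: `Sum.inl i` is the even index `i + 1` and `Sum.inr p` is
the odd index `m + p + 1` (entries of `Fin` are counted from zero). The total order on indices is
the one of `Fin m ⊕ₗ Fin n`. -/
abbrev Idx (m n : ℕ) : Type := Fin m ⊕ Fin n

/-- The parity of an index. -/
def parity {m n : ℕ} : Idx m n → ℕ
  | Sum.inl _ => 0
  | Sum.inr _ => 1

/-- The sign `(-1)^{deg E_{ij} · deg E_{kl}}`. -/
def sgn {m n : ℕ} (i j k l : Idx m n) : ℂ :=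
  (-1) ^ ((parity i + parity j) * (parity k + parity l))

/-- The free generator with indices `i, j`. -/
def gen {m n : ℕ} (i j : Idx m n) : FreeAlgebra ℂ (Idx m n × Idx m n) :=
  FreeAlgebra.ι ℂ (i, j)

/-- The defining relations of the universal enveloping algebra of `gl_{m|n}`: the super-commutator
of `E_{ij}` and `E_{kl}` equals `δ_{kj} E_{il} - δ_{il} E_{kj} (-1)^{deg E_{ij} · deg E_{kl}}`. -/
inductive Rel (m n : ℕ) : FreeAlgebra ℂ (Idx m n × Idx m n) →
    FreeAlgebra ℂ (Idx m n × Idx m n) → Prop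
  | comm (i j k l : Idx m n) :
      Rel m n (gen i j * gen k l - sgn i j k l • (gen k l * gen i j))
        ((if k = j then gen i l else 0) - (if i = l then sgn i j k l • gen k j else 0))

/-- The universal enveloping algebra `U(gl_{m|n})` over `ℂ`. Representations of the Lie
superalgebra `gl_{m|n}` are modules over this algebra. -/
abbrev U (m n : ℕ) : Type := RingQuot (Rel m n)

/-- The image in `U(gl_{m|n})` of the standard basis element `E_{ij}`. -/
noncomputable def E {m n : ℕ} (i j : Idx m n) : U m n :=
  RingQuot.mkAlgHom ℂ (Rel m n) (gen i j)

/-- `h_i = E_{ii} - i + 1` for `i = 1, …, m` (with `i` counted from zero: `E_{ii} - i`). -/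
noncomputable def h {m n : ℕ} (i : Fin m) : U m n :=
  E (Sum.inl i) (Sum.inl i) - algebraMap ℂ (U m n) ((i : ℕ) : ℂ)

/-- For a list `[i₁, …, i_s]` the product `E_{i₁ i} E_{i₂ i₁} ⋯ E_{i_s i_{s-1}} E_{a i_s}`
(which is `E_{a i}` when the list is empty). -/
noncomputable def lowerChain {m n : ℕ} (a : Fin n) : Fin m → List (Fin m) → U m n
  | i, [] => E (Sum.inr a) (Sum.inl i)
  | i, k :: l => E (Sum.inl k) (Sum.inl i) * lowerChain a k l

/-- The lowering operator `z_{ai}`: the sum over all `i < i₁ < ⋯ < i_s ≤ m` of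
`E_{i₁ i} E_{i₂ i₁} ⋯ E_{i_s i_{s-1}} E_{a i_s} (h_i - h_{j₁}) ⋯ (h_i - h_{j_r})`, where
`{j₁, …, j_r}` is the complement of `{i₁, …, i_s}` in `{i + 1, …, m}`. -/
noncomputable def zLower {m n : ℕ} (a : Fin n) (i : Fin m) : U m n :=
  ∑ S ∈ (Finset.Ioi i).powerset,
    lowerChain a i (S.sort (· ≤ ·)) *
      (((Finset.Ioi i \ S).sort (· ≤ ·)).map fun j => h i - h j).prod

/-- The product `z_{m+k,j} ⋯ z_{m+2,j} z_{m+1,j}` (for `k ≤ n`). -/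
noncomputable def zBlock {m n : ℕ} (j : Fin m) (k : ℕ) : U m n :=
  ((((List.finRange n).filter fun p : Fin n => p.val < k).reverse).map fun p => zLower p j).prod

/-- The product over `j = 1, …, m`, in increasing order of `j` from left to right, of the elements
`z_{m+λ_j-μ_j,j} ⋯ z_{m+2,j} z_{m+1,j}`. It is used only when `0 ≤ λ_j - μ_j ≤ n` for all `j`. -/
noncomputable def zProd {m n : ℕ} (lam : Idx m n → ℕ) (mu : Fin m → ℕ) : U m n :=
  (List.ofFn fun j : Fin m => zBlock j (lam (Sum.inl j) - mu j)).prod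

/-- Covariant highest weights: tuples `(λ_1, …, λ_m | λ_{m+1}, …, λ_{m+n})` of nonnegative integers,
weakly decreasing in each of the two groups, such that the number of nonzero components among
`λ_{m+1}, …, λ_{m+n}` does not exceed `λ_m`. -/
structure IsCovariant {m n : ℕ} (lam : Idx m n → ℕ) : Prop where
  anti_left : ∀ i j : Fin m, i ≤ j → lam (Sum.inl j) ≤ lam (Sum.inl i)
  anti_right : ∀ p q : Fin n, p ≤ q → lam (Sum.inr q) ≤ lam (Sum.inr p)
  hook : ∀ i : Fin m, (i : ℕ) + 1 = m →
    (Finset.univ.filter fun p : Fin n => lam (Sum.inr p) ≠ 0).card ≤ lam (Sum.inl i)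

/-- `V` is the irreducible highest weight representation `L(λ)` of `gl_{m|n}` and `v` is its highest
vector. (A nonzero vector of an irreducible module generates it.) -/
structure IsIrredHighestWeight {m n : ℕ} (V : Type*) [AddCommGroup V] [Module ℂ V]
    [Module (U m n) V] [IsScalarTower ℂ (U m n) V] (lam : Idx m n → ℂ) (v : V) : Prop where
  irreducible : IsSimpleModule (U m n) V
  ne_zero : v ≠ 0
  raising : ∀ i j : Idx m n, toLex i < toLex j → (E i j : U m n) • v = 0
  weight : ∀ i : Idx m n, (E i i : U m n) • v = lam i • v

/-- The multiplicity space `V^+_μ`: the vectors killed by all `E_{ij}` with `1 ≤ i < j ≤ m`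
and such that `E_{ii}` acts as `μ_i` for `i = 1, …, m`. -/
def multiplicitySpace {m : ℕ} (n : ℕ) (V : Type*) [AddCommGroup V] [Module ℂ V]
    [Module (U m n) V] [IsScalarTower ℂ (U m n) V]
    (mu : Fin m → ℂ) : Submodule ℂ V where
  carrier := {v | (∀ i j : Fin m, i < j → (E (Sum.inl i) (Sum.inl j) : U m n) • v = 0) ∧
    ∀ i : Fin m, (E (Sum.inl i) (Sum.inl i) : U m n) • v = mu i • v}
  add_mem' := by
    rintro v w ⟨h1, h2⟩ ⟨h3, h4⟩
    exact ⟨fun i j hij => by rw [smul_add, h1 i j hij, h3 i j hij, add_zero],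
      fun i => by rw [smul_add, h2 i, h4 i, smul_add]⟩
  zero_mem' := ⟨fun i j _ => smul_zero _, fun i => by rw [smul_zero, smul_zero]⟩
  smul_mem' := by
    rintro c v ⟨h1, h2⟩
    refine ⟨fun i j hij => ?_, fun i => ?_⟩
    · rw [← algebraMap_smul (U m n) c v, ← mul_smul, ← Algebra.commutes, mul_smul, h1 i j hij,
        smul_zero]
    · rw [← algebraMap_smul (U m n) c v, ← mul_smul, ← Algebra.commutes, mul_smul, h2 i,
        algebraMap_smul, algebraMap_smul, smul_comm]

end GLSuper

/-! That the vector is singular of weight `mu` follows by applying the factors `z_{aj}` one at a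
time: each sends `gl_m`-singular vectors to `gl_m`-singular vectors whenever the differences of
shifted weights to its right are nonzero (`Sing.lowerEnd`, `zPairs_smul`).

Nonvanishing is detected by a functional. Transposing the operators makes the dual of `L` a
representation, and a functional `φ₀` with `φ₀ v = 1` that kills everything strictly below `v` is a
highest vector there, again of weight `lam` (`exists_dual_highest`). From `φ₀` one builds a
`gl_m`-singular functional `φ` that the odd raising operators, taken over exactly the pairs `(a, j)`
occurring in `zProd`, carry back to a nonzero multiple of `φ₀` (`exists_tower`).

Two consequences combine. Being singular for the transposed action, `φ` kills the image of every
`E_{kl}` with `l < k ≤ m`, so only the leading term `E_{aj}` of each `z_{aj}` survives under `φ`,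
with a nonzero coefficient. And `φ` of the product of these `E_{aj}` applied to `v` is, by
transposition, the product of raising operators applied to `φ` and evaluated at `v`. These operators
anticommute, so their order affects only the sign, and the value is a nonzero multiple of `φ₀ v =
1`.

The tower treats one odd index `a` at a time inside the corresponding `gl_{m|1}` (`exists_level`).
Its constant comes from the closed formula `raiseList_raise_lowerEnd`; it is nonzero because the
weights are nonnegative integers and the shifted weight differences avoid `0` and `1` where
necessary. -/

namespace GLSuper

/-! ### Commutation relations and the lowering operators for `gl_m`-singular vectors. -/

section Operators

variable {m n : ℕ} {W : Type*} [AddCommGroup W] [Module ℂ W]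

/-- The operators `e i j` define a representation of `gl_{m|n}`. -/
def IsRep (e : Idx m n → Idx m n → Module.End ℂ W) : Prop :=
  ∀ i j k l w, e i j (e k l w) - sgn i j k l • e k l (e i j w) =
    (if k = j then e i l w else 0) - (if i = l then sgn i j k l • e k j w else 0)

namespace IsRep

variable {e : Idx m n → Idx m n → Module.End ℂ W} (he : IsRep e)

include he

theorem even_even (p q r s : Fin m) (w : W) :
    e (.inl p) (.inl q) (e (.inl r) (.inl s) w) = e (.inl r) (.inl s) (e (.inl p) (.inl q) w) +
      (if r = q then e (.inl p) (.inl s) w else 0) - (if p = s then e (.inl r) (.inl q) w else 0) := by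
  have := he (.inl p) (.inl q) (.inl r) (.inl s) w
  simp only [sgn, parity, Sum.inl.injEq, add_zero, mul_zero, pow_zero, one_smul] at this
  rw [sub_eq_iff_eq_add] at this
  rw [this]; abel

theorem even_lower (p q s : Fin m) (a : Fin n) (w : W) :
    e (.inl p) (.inl q) (e (.inr a) (.inl s) w) = e (.inr a) (.inl s) (e (.inl p) (.inl q) w) -
      (if p = s then e (.inr a) (.inl q) w else 0) := by
  have := he (.inl p) (.inl q) (.inr a) (.inl s) w
  simp only [sgn, parity, Sum.inl.injEq, add_zero, zero_mul, pow_zero, one_smul, reduceCtorEq,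
    if_false, zero_sub] at this
  rw [sub_eq_iff_eq_add] at this
  rw [this]; abel

theorem even_raise (p q s : Fin m) (a : Fin n) (w : W) :
    e (.inl p) (.inl q) (e (.inl s) (.inr a) w) = e (.inl s) (.inr a) (e (.inl p) (.inl q) w) +
      (if s = q then e (.inl p) (.inr a) w else 0) := by
  have := he (.inl p) (.inl q) (.inl s) (.inr a) w
  simp only [sgn, parity, Sum.inl.injEq, add_zero, zero_mul, pow_zero, one_smul, reduceCtorEq,
    if_false, sub_zero] at this
  rw [sub_eq_iff_eq_add] at this
  rw [this]; abel

theorem raise_lower (p q : Fin m) (a b : Fin n) (w : W) :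
    e (.inl p) (.inr a) (e (.inr b) (.inl q) w) = -e (.inr b) (.inl q) (e (.inl p) (.inr a) w) +
      (if b = a then e (.inl p) (.inl q) w else 0) +
      (if p = q then e (.inr b) (.inr a) w else 0) := by
  have := he (.inl p) (.inr a) (.inr b) (.inl q) w
  simp only [sgn, parity, Sum.inl.injEq, Sum.inr.injEq, add_zero, zero_add, mul_one, pow_one,
    neg_smul, one_smul, sub_neg_eq_add] at this
  rw [← eq_sub_iff_add_eq] at this
  rw [this]; split_ifs <;> simp <;> abel

theorem raise_raise (p q : Fin m) (a b : Fin n) (w : W) :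
    e (.inl p) (.inr a) (e (.inl q) (.inr b) w) = -e (.inl q) (.inr b) (e (.inl p) (.inr a) w) := by
  have := he (.inl p) (.inr a) (.inl q) (.inr b) w
  simp only [sgn, parity, reduceCtorEq, zero_add, mul_one, pow_one,
    neg_smul, one_smul, sub_neg_eq_add, if_false, sub_zero] at this
  exact eq_neg_of_add_eq_zero_left this

theorem raise_raise_self (p : Fin m) (a : Fin n) (w : W) :
    e (.inl p) (.inr a) (e (.inl p) (.inr a) w) = 0 :=
  by
  have h := he.raise_raise p p a a w
  rw [eq_neg_iff_add_eq_zero, ← two_smul ℂ] at h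
  exact (smul_eq_zero.mp h).resolve_left two_ne_zero

theorem cartan (x y z : Idx m n) (w : W) :
    e x x (e y z w) = e y z (e x x w) + ((if x = y then 1 else 0) - (if x = z then 1 else 0) : ℂ) •
      e y z w := by
  have := he x x y z w
  have hs : sgn x x y z = 1 := by
    rcases x with x | x <;> simp [sgn, parity, ← two_mul]
  rw [hs, one_smul, sub_eq_iff_eq_add] at this
  rw [this]
  rcases eq_or_ne x y with rfl | h1
  · rcases eq_or_ne x z with rfl | h2
    · simp
    · simp [h2, add_comm]
  · rcases eq_or_ne x z with rfl | h2
    · simp only [if_neg h1, if_neg (Ne.symm h1), if_true, one_smul]; module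
    · simp [h1, h2, Ne.symm h1]

/-- The transposed operators on the dual space. -/
theorem dual : IsRep (fun i j => (e j i).dualMap) := by
  intro i j k l f
  ext w
  -- Transposition reverses composition, so the relation needed is the one with all four indices
  -- reversed; its sign is the same.
  have := congrArg f (he l k j i w)
  have hs : sgn l k j i = sgn i j k l := by
    simp only [sgn]; congr 1; ring
  rw [hs, map_sub, map_sub, map_smul] at this
  simp only [LinearMap.sub_apply, LinearMap.smul_apply, LinearMap.dualMap_apply, this]
  congr 1
  · rcases eq_or_ne k j with rfl | h <;> simp [*, Ne.symm]
  · rcases eq_or_ne i l with rfl | h <;> simp [*, Ne.symm]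

end IsRep

/-- `w` is a singular vector for `gl_m` of weight `f`. -/
structure Sing (e : Idx m n → Idx m n → Module.End ℂ W) (f : Fin m → ℂ) (w : W) : Prop where
  raising : ∀ p q : Fin m, p < q → e (.inl p) (.inl q) w = 0
  weight : ∀ p : Fin m, e (.inl p) (.inl p) w = f p • w

theorem Sing.smul {e : Idx m n → Idx m n → Module.End ℂ W} {f : Fin m → ℂ} {w : W}
    (hw : Sing e f w) (c : ℂ) : Sing e f (c • w) :=
  ⟨fun p q h => by rw [map_smul, hw.raising p q h, smul_zero],
    fun p => by rw [map_smul, hw.weight, smul_comm]⟩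

/-- The action of `lowerChain`. -/
def chainEnd (e : Idx m n → Idx m n → Module.End ℂ W) (a : Fin n) :
    Fin m → List (Fin m) → Module.End ℂ W
  | i, [] => e (.inr a) (.inl i)
  | i, k :: l => e (.inl k) (.inl i) * chainEnd e a k l

/-- The lowering operator with denominators `c`. -/
noncomputable def lowerEnd (e : Idx m n → Idx m n → Module.End ℂ W) (a : Fin n) (c : Fin m → ℂ)
    (k : Fin m) : Module.End ℂ W :=
  ∑ S ∈ (Finset.Ioi k).powerset, (∏ j ∈ S, (c j)⁻¹) • chainEnd e a k (S.sort (· ≤ ·))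

theorem sum_powerset_by_min {α M : Type*} [LinearOrder α] [AddCommMonoid M] (F : Finset α → M)
    (s : Finset α) : ∑ S ∈ s.powerset, F S =
      F ∅ + ∑ k ∈ s, ∑ S ∈ (s.filter (k < ·)).powerset, F (insert k S) := by
  induction s using Finset.induction_on_min with
  | empty => simp
  | insert b s hb ih =>
    have hbs : b ∉ s := fun h => lt_irrefl _ (hb b h)
    rw [Finset.sum_powerset_insert hbs, ih, Finset.sum_insert hbs, add_assoc, add_comm (∑ k ∈ s, _)]
    congr 2
    · rw [Finset.filter_insert, if_neg (lt_irrefl b), Finset.filter_true_of_mem hb]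
    · refine Finset.sum_congr rfl fun k hk => ?_
      rw [Finset.filter_insert, if_neg (hb k hk).not_gt]

/-- Splitting the subsets by their least element gives a recursion in `k`; all later facts about
`lowerEnd` are downward inductions based on it. -/
theorem lowerEnd_apply (e : Idx m n → Idx m n → Module.End ℂ W) (a : Fin n) (c : Fin m → ℂ)
    (k : Fin m) (w : W) : lowerEnd e a c k w = e (.inr a) (.inl k) w +
      ∑ k' ∈ Finset.Ioi k, (c k')⁻¹ • e (.inl k') (.inl k) (lowerEnd e a c k' w) := by
  have hfil : ∀ k' ∈ Finset.Ioi k, (Finset.Ioi k).filter (k' < ·) = Finset.Ioi k' := by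
    intro k' hk'
    ext x
    simp only [Finset.mem_Ioi, Finset.mem_filter] at hk' ⊢
    exact ⟨fun h => h.2, fun h => ⟨hk'.trans h, h⟩⟩
  rw [lowerEnd, sum_powerset_by_min, LinearMap.add_apply, LinearMap.sum_apply]
  congr 1
  · simp [chainEnd]
  · refine Finset.sum_congr rfl fun k' hk' => ?_
    rw [hfil k' hk', lowerEnd, LinearMap.sum_apply, LinearMap.sum_apply, map_sum, Finset.smul_sum]
    refine Finset.sum_congr rfl fun S hS => ?_
    have hlt : ∀ {b}, b ∈ S → k' < b := fun hb => Finset.mem_Ioi.mp (Finset.mem_powerset.mp hS hb)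
    have hn : k' ∉ S := fun h => lt_irrefl _ (hlt h)
    rw [Finset.prod_insert hn, Finset.sort_insert _ (fun b hb => (hlt hb).le) hn, chainEnd]
    simp [mul_smul]

theorem lowerEnd_mem {e : Idx m n → Idx m n → Module.End ℂ W} (a : Fin n) (c : Fin m → ℂ)
    {D : Submodule ℂ W} {k : Fin m}
    (h1 : ∀ p, k ≤ p → ∀ w ∈ D, e (.inr a) (.inl p) w ∈ D)
    (h2 : ∀ p q, k ≤ p → p < q → ∀ w ∈ D, e (.inl q) (.inl p) w ∈ D) {w : W} (hw : w ∈ D) :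
    lowerEnd e a c k w ∈ D := by
  induction k using WellFoundedGT.induction with
  | ind k ih =>
    rw [lowerEnd_apply]
    refine add_mem (h1 k le_rfl w hw) (sum_mem fun k' hk' => D.smul_mem _ ?_)
    have hlt := Finset.mem_Ioi.mp hk'
    exact h2 k k' le_rfl hlt _ (ih k' hlt (fun p hp => h1 p (hlt.le.trans hp))
      fun p q hp => h2 p q (hlt.le.trans hp))

variable {e : Idx m n → Idx m n → Module.End ℂ W} (he : IsRep e)

include he

/-- The weight of `lowerEnd e a c k w`. -/
theorem lowerEnd_weight (a : Fin n) (c : Fin m → ℂ) (k : Fin m) (x : Idx m n) {w : W} {t : ℂ}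
    (hw : e x x w = t • w) : e x x (lowerEnd e a c k w) =
      (t + (if x = .inr a then 1 else 0) - (if x = .inl k then 1 else 0)) •
        lowerEnd e a c k w := by
  induction k using WellFoundedGT.induction with
  | ind k ih =>
    rw [lowerEnd_apply, map_add, smul_add, map_sum, Finset.smul_sum, he.cartan, hw, map_smul]
    congr 1
    · module
    · refine Finset.sum_congr rfl fun k' hk' => ?_
      rw [map_smul, he.cartan, ih k' (Finset.mem_Ioi.mp hk'), map_smul]
      module

/-- Since `p < k` and `q ≤ k < k'`, the operator `E_{pq}` commutes with every `E_{ak}` and `E_{k'k}`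
that occurs, and so reaches `w`. -/
theorem lowerEnd_raise_lt (a : Fin n) (c : Fin m → ℂ) {p q k : Fin m} (hpk : p < k) {w : W}
    (hw : e (.inl p) (.inl q) w = 0) (hqk : q ≤ k) :
    e (.inl p) (.inl q) (lowerEnd e a c k w) = 0 := by
  induction k using WellFoundedGT.induction with
  | ind k ih =>
    rw [lowerEnd_apply, map_add, map_sum, he.even_lower, hw, if_neg hpk.ne, map_zero, sub_zero,
      zero_add]
    refine Finset.sum_eq_zero fun k' hk' => ?_
    have hk := Finset.mem_Ioi.mp hk'
    rw [map_smul, he.even_even, ih k' hk (hpk.trans hk) (hqk.trans hk.le), map_zero,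
      if_neg (hqk.trans_lt hk).ne', if_neg hpk.ne]
    simp

/-- The parameter `u` stays free so that one family `c` serves all `k` in the recursion. For `u` the
shifted weight at `k`, the factor `c k` vanishes, which is why the lowering operator at that index
gives a singular vector. -/
theorem lowerEnd_raise_eq (a : Fin n) {f : Fin m → ℂ} {u : ℂ} {c : Fin m → ℂ}
    (hc : ∀ k, c k = u - (f k - (k : ℕ))) {w : W} (hw : Sing e f w) {k q : Fin m}
    (hkq : (k : ℕ) + 1 = q) (hcq : c q ≠ 0) :
    e (.inl k) (.inl q) (lowerEnd e a c k w) = -(c k / c q) • lowerEnd e a c q w := by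
  have hlt : k < q := by rw [Fin.lt_def]; omega
  have hset : Finset.Ioi k = insert q (Finset.Ioi q) := by
    ext x; simp only [Finset.mem_Ioi, Finset.mem_insert, Fin.lt_def, Fin.ext_iff]; omega
  have h1 : ∀ k' ∈ Finset.Ioi q, e (.inl k) (.inl q) ((c k')⁻¹ • e (.inl k') (.inl k)
      (lowerEnd e a c k' w)) = -((c k')⁻¹ • e (.inl k') (.inl q) (lowerEnd e a c k' w)) := by
    intro k' hk'
    have hq := Finset.mem_Ioi.mp hk'
    rw [map_smul, he.even_even, if_neg hq.ne', if_pos rfl,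
      lowerEnd_raise_lt he a c (hlt.trans hq) (hw.raising k q hlt) hq.le]
    simp
  have h2 : e (.inl k) (.inl q) ((c q)⁻¹ • e (.inl q) (.inl k) (lowerEnd e a c q w)) =
      ((c q)⁻¹ * (f k - f q + 1)) • lowerEnd e a c q w := by
    rw [map_smul, he.even_even, if_pos rfl, if_pos rfl,
      lowerEnd_raise_lt he a c hlt (hw.raising k q hlt) le_rfl,
      lowerEnd_weight he a c q _ (hw.weight k), lowerEnd_weight he a c q _ (hw.weight q),
      if_neg (by simp), if_neg (by simpa using hlt.ne), if_neg (by simp), if_pos rfl, map_zero,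
      zero_add, ← sub_smul, smul_smul]
    congr 2
    ring
  rw [lowerEnd_apply, map_add, map_sum, he.even_lower, hw.raising k q hlt, map_zero, if_pos rfl,
    hset, Finset.sum_insert (by simp), h2, Finset.sum_congr rfl h1, Finset.sum_neg_distrib]
  -- Because `q = k + 1`, the shift in `c` makes `c q - c k = f k - f q + 1`.
  have h3 : c k / c q = 1 - (c q)⁻¹ * (f k - f q + 1) := by
    have hq : ((q : ℕ) : ℂ) = (k : ℕ) + 1 := by rw [← hkq]; push_cast; ring
    field_simp
    rw [hc k, hc q, hq]; ring
  rw [h3, lowerEnd_apply e a c q]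
  module

theorem raising_of_simple {w : W}
    (h : ∀ p q : Fin m, (p : ℕ) + 1 = q → e (.inl p) (.inl q) w = 0) (p q : Fin m) (hpq : p < q) :
    e (.inl p) (.inl q) w = 0 := by
  obtain ⟨d, hd⟩ : ∃ d : ℕ, (p : ℕ) + 1 + d = q := ⟨q - (p + 1), by rw [Fin.lt_def] at hpq; omega⟩
  induction d generalizing q with
  | zero => exact h p q (by omega)
  | succ d ih =>
    let r : Fin m := ⟨p + 1 + d, by omega⟩
    have hr : (r : ℕ) = p + 1 + d := rfl
    have h1 := ih r (by rw [Fin.lt_def]; omega) hr.symm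
    have h2 := h r q (by omega)
    have := he.even_even p r r q w
    rw [h1, h2, map_zero, map_zero, if_pos rfl, if_neg hpq.ne] at this
    simpa using this.symm

/-- Only the terms `k' = p` and `k' = q` of the recursion contribute: the first through
`lowerEnd_raise_eq`, the second through `[E_{pq}, E_{qk}] = E_{pk}`, and they cancel. -/
theorem lowerEnd_raise_gt (a : Fin n) {f : Fin m → ℂ} {u : ℂ} {c : Fin m → ℂ}
    (hc : ∀ k, c k = u - (f k - (k : ℕ))) {w : W} (hw : Sing e f w) {k p q : Fin m}
    (hpq : (p : ℕ) + 1 = q) (hcp : c p ≠ 0) (hcq : c q ≠ 0) (hkp : k < p) :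
    e (.inl p) (.inl q) (lowerEnd e a c k w) = 0 := by
  have hlt : p < q := by rw [Fin.lt_def]; omega
  induction k using WellFoundedGT.induction with
  | ind k ih =>
    have hz : ∀ k' ∈ Finset.Ioi k, k' ≠ p → e (.inl p) (.inl q) (lowerEnd e a c k' w) = 0 := by
      intro k' hk' hne
      rcases hne.lt_or_gt with h | h
      · exact ih k' (Finset.mem_Ioi.mp hk') h
      · exact lowerEnd_raise_lt he a c h (hw.raising p q hlt) (by
          rw [Fin.lt_def] at h; rw [Fin.le_def]; omega)
    have hterm : ∀ k' ∈ Finset.Ioi k, e (.inl p) (.inl q) ((c k')⁻¹ • e (.inl k') (.inl k)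
        (lowerEnd e a c k' w)) =
        (if k' = p then -((c q)⁻¹ • e (.inl p) (.inl k) (lowerEnd e a c q w)) else 0) +
        (if k' = q then (c q)⁻¹ • e (.inl p) (.inl k) (lowerEnd e a c q w) else 0) := by
      intro k' hk'
      rw [map_smul, he.even_even, if_neg hkp.ne', sub_zero, smul_add]
      congr 1
      · split_ifs with h
        · subst h
          rw [lowerEnd_raise_eq he a hc hw hpq hcq, map_smul, smul_smul, ← neg_smul]
          congr 1
          field_simp
        · rw [hz k' hk' h, map_zero, smul_zero]
      · split_ifs with h
        · rw [h]
        · exact smul_zero _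
    rw [lowerEnd_apply, map_add, map_sum, he.even_lower, hw.raising p q hlt, map_zero,
      if_neg hkp.ne', Finset.sum_congr rfl hterm, Finset.sum_add_distrib, Finset.sum_ite_eq',
      Finset.sum_ite_eq', if_pos (Finset.mem_Ioi.mpr hkp),
      if_pos (Finset.mem_Ioi.mpr (hkp.trans hlt))]
    simp

/-- The lowering operators preserve singular vectors. -/
theorem Sing.lowerEnd (a : Fin n) {f : Fin m → ℂ} {i : Fin m} {c : Fin m → ℂ}
    (hc : ∀ k, c k = (f i - (i : ℕ)) - (f k - (k : ℕ))) (hc0 : ∀ k, i < k → c k ≠ 0) {w : W}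
    (hw : Sing e f w) :
    Sing e (fun k => f k - if k = i then 1 else 0) (lowerEnd e a c i w) := by
  refine ⟨raising_of_simple he fun p q hpq => ?_, fun p => ?_⟩
  · have hlt : p < q := by rw [Fin.lt_def]; omega
    rcases lt_trichotomy p i with h | rfl | h
    · exact lowerEnd_raise_lt he a c h (hw.raising p q hlt) (by
        rw [Fin.lt_def] at h; rw [Fin.le_def]; omega)
    · rw [lowerEnd_raise_eq he a hc hw hpq (hc0 q hlt), hc p]
      simp
    · exact lowerEnd_raise_gt he a hc hw hpq (hc0 p h) (hc0 q (h.trans hlt)) h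
  · rw [lowerEnd_weight he a c i _ (hw.weight p)]
    congr 1
    simp

end Operators

/-! ### Height grading on a highest weight module and the dual highest vector. -/

section Triangular

variable {m n : ℕ} {W : Type*} [AddCommGroup W] [Module ℂ W]

/-- The position of an index in the total order. -/
def pos : Idx m n → ℕ
  | .inl i => i
  | .inr a => m + a

theorem pos_injective : Function.Injective (pos : Idx m n → ℕ) := by
  rintro (i | a) (j | b) h <;> simp only [pos] at h
  · rw [Fin.ext h]
  · omega
  · omega
  · rw [Fin.ext (by omega : (a : ℕ) = b)]

theorem toLex_lt_iff (x y : Idx m n) : toLex x < toLex y ↔ pos x < pos y := by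
  rcases x with i | a <;> rcases y with j | b
  · simp [pos]
  · simp only [pos, Sum.Lex.inl_lt_inr, true_iff]; omega
  · simp only [pos, Sum.Lex.not_inr_lt_inl, false_iff]; omega
  · simp [pos]

/-- `w` is a highest weight vector for the subalgebra spanned by `e x y`, `x, y ∈ I`. -/
structure HighestOn (e : Idx m n → Idx m n → Module.End ℂ W) (I : Finset (Idx m n))
    (lam : Idx m n → ℂ) (w : W) : Prop where
  raising : ∀ x ∈ I, ∀ y ∈ I, pos x < pos y → e x y w = 0
  weight : ∀ x ∈ I, e x x w = lam x • w

/-- Monomials of height `N` in lowering operators, applied to `ξ`. -/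
inductive LowerMonomial (e : Idx m n → Idx m n → Module.End ℂ W) (I : Finset (Idx m n)) (ξ : W) :
    ℕ → W → Prop
  | base : LowerMonomial e I ξ 0 ξ
  | step (x y : Idx m n) (N : ℕ) (w : W) (hx : x ∈ I) (hy : y ∈ I) (hxy : pos y < pos x)
      (hw : LowerMonomial e I ξ N w) : LowerMonomial e I ξ (N + (pos x - pos y)) (e x y w)

/-- The span of all lowering monomials of height at least `N₀`. -/
def lowerSpan (e : Idx m n → Idx m n → Module.End ℂ W) (I : Finset (Idx m n)) (ξ : W) (N₀ : ℕ) :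
    Submodule ℂ W :=
  Submodule.span ℂ {w | ∃ N, N₀ ≤ N ∧ LowerMonomial e I ξ N w}

/-- The sum of the Cartan operators weighted by position. -/
noncomputable def posOp (e : Idx m n → Idx m n → Module.End ℂ W) (I : Finset (Idx m n)) :
    Module.End ℂ W :=
  ∑ x ∈ I, (pos x : ℂ) • e x x

variable {e : Idx m n → Idx m n → Module.End ℂ W} {I : Finset (Idx m n)} {lam : Idx m n → ℂ}
  {ξ : W}

theorem self_mem_lowerSpan : ξ ∈ lowerSpan e I ξ 0 :=
  Submodule.subset_span ⟨0, le_rfl, .base⟩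

theorem lowerSpan_lower {N : ℕ} {x y : Idx m n} (hx : x ∈ I) (hy : y ∈ I) (hxy : pos y < pos x)
    {w : W} (hw : w ∈ lowerSpan e I ξ N) : e x y w ∈ lowerSpan e I ξ (N + 1) := by
  induction hw using Submodule.span_induction with
  | mem w h =>
    obtain ⟨M, hM, h⟩ := h
    exact Submodule.subset_span ⟨_, by omega, .step x y M w hx hy hxy h⟩
  | zero => rw [map_zero]; exact zero_mem _
  | add v w _ _ h1 h2 => rw [map_add]; exact add_mem h1 h2
  | smul c w _ h => rw [map_smul]; exact Submodule.smul_mem _ _ h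

theorem lowerSpan_mono {N M : ℕ} (h : N ≤ M) : lowerSpan e I ξ M ≤ lowerSpan e I ξ N :=
  Submodule.span_mono fun _ ⟨K, hK, hw⟩ => ⟨K, h.trans hK, hw⟩

variable (he : IsRep e)

include he

theorem posOp_apply {x y : Idx m n} (hx : x ∈ I) (hy : y ∈ I) (w : W) :
    posOp e I (e x y w) = e x y (posOp e I w) + ((pos x : ℂ) - pos y) • e x y w := by
  have h : ∀ z ∈ I, ((pos z : ℂ) • e z z) (e x y w) = e x y (((pos z : ℂ) • e z z) w) +
      ((if z = x then (pos z : ℂ) else 0) - (if z = y then (pos z : ℂ) else 0)) • e x y w := by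
    intro z _
    rw [LinearMap.smul_apply, LinearMap.smul_apply, he.cartan, map_smul, smul_add, smul_smul]
    congr 2
    split_ifs <;> ring
  rw [posOp, LinearMap.sum_apply, LinearMap.sum_apply, map_sum, Finset.sum_congr rfl h,
    Finset.sum_add_distrib, ← Finset.sum_smul, Finset.sum_sub_distrib, Finset.sum_ite_eq',
    Finset.sum_ite_eq', if_pos hx, if_pos hy]

variable (hξ : HighestOn e I lam ξ)

include hξ

theorem LowerMonomial.posOp_eq {N : ℕ} {w : W} (hw : LowerMonomial e I ξ N w) :
    posOp e I w = ((∑ x ∈ I, (pos x : ℂ) * lam x) + N) • w := by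
  induction hw with
  | base =>
    rw [posOp, LinearMap.sum_apply, Nat.cast_zero, add_zero, Finset.sum_smul]
    refine Finset.sum_congr rfl fun x hx => ?_
    rw [LinearMap.smul_apply, hξ.weight x hx, smul_smul]
  | step x y N w hx hy hxy _ ih =>
    rw [posOp_apply he hx hy, ih, map_smul, Nat.cast_add, Nat.cast_sub hxy.le]
    module

theorem LowerMonomial.cartan_eq {N : ℕ} {w : W} (hw : LowerMonomial e I ξ N w) {x : Idx m n}
    (hx : x ∈ I) : ∃ t : ℂ, e x x w = t • w := by
  induction hw with
  | base => exact ⟨_, hξ.weight x hx⟩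
  | step y z N w hy hz hyz _ ih =>
    obtain ⟨t, ht⟩ := ih
    exact ⟨t + _, by rw [he.cartan, ht, map_smul, add_smul]⟩

theorem LowerMonomial.mem_lowerSpan {N : ℕ} {w : W} (hw : LowerMonomial e I ξ N w) {x y : Idx m n}
    (hx : x ∈ I) (hy : y ∈ I) : e x y w ∈ lowerSpan e I ξ 0 := by
  induction hw generalizing x y with
  | base =>
    rcases lt_trichotomy (pos x) (pos y) with h | h | h
    · rw [hξ.raising x hx y hy h]; exact zero_mem _
    · rw [pos_injective h, hξ.weight y hy]; exact Submodule.smul_mem _ _ self_mem_lowerSpan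
    · exact Submodule.subset_span ⟨_, by omega, .step x y 0 ξ hx hy h .base⟩
  | step k l N w hk hl hkl _ ih =>
    have := he x y k l w
    rw [sub_eq_iff_eq_add] at this
    rw [this]
    refine add_mem (sub_mem ?_ ?_) (Submodule.smul_mem _ _ ?_)
    · split_ifs
      · exact ih hx hl
      · exact zero_mem _
    · split_ifs
      · exact Submodule.smul_mem _ _ (ih hk hy)
      · exact zero_mem _
    · exact lowerSpan_mono (Nat.zero_le _) (lowerSpan_lower hk hl hkl (ih hx hy))

theorem lowerSpan_stable {w : W} (hw : w ∈ lowerSpan e I ξ 0) {x y : Idx m n} (hx : x ∈ I)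
    (hy : y ∈ I) : e x y w ∈ lowerSpan e I ξ 0 := by
  induction hw using Submodule.span_induction with
  | mem w h =>
    obtain ⟨M, hM, h⟩ := h
    exact h.mem_lowerSpan he hξ hx hy
  | zero => rw [map_zero]; exact zero_mem _
  | add v w _ _ h1 h2 => rw [map_add]; exact add_mem h1 h2
  | smul c w _ h => rw [map_smul]; exact Submodule.smul_mem _ _ h

/-- Lowering monomials are eigenvectors of `posOp` with eigenvalue determined by height, and
eigenspaces for distinct eigenvalues are independent. No finiteness of dimension is needed. -/
theorem eq_zero_of_mem_lowerSpan {N₀ : ℕ} {w : W} (hw : w ∈ lowerSpan e I ξ N₀) {c : ℂ}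
    (hc : posOp e I w = c • w) (hne : ∀ N, N₀ ≤ N → c ≠ (∑ x ∈ I, (pos x : ℂ) * lam x) + N) :
    w = 0 := by
  have hle : lowerSpan e I ξ N₀ ≤ ⨆ (d : ℂ) (_ : d ≠ c), (posOp e I).eigenspace d := by
    refine Submodule.span_le.mpr ?_
    rintro x ⟨N, hN, hx⟩
    exact Submodule.mem_iSup_of_mem _ (Submodule.mem_iSup_of_mem (hne N hN).symm
      (Module.End.mem_eigenspace_iff.mpr (hx.posOp_eq he hξ)))
  exact Submodule.disjoint_def.mp ((posOp e I).eigenspaces_iSupIndep c) w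
    (Module.End.mem_eigenspace_iff.mpr hc) (hle hw)

/-- A functional on a module generated by a highest vector, which is a highest vector of the dual
module. -/
theorem exists_dual_highest (hI : I = Finset.univ) (hξ0 : ξ ≠ 0) (htop : lowerSpan e I ξ 0 = ⊤) :
    ∃ φ : Module.Dual ℂ W, φ ξ = 1 ∧ HighestOn (fun i j => (e j i).dualMap) I lam φ := by
  have hmem : ∀ x, x ∈ I := fun x => hI ▸ Finset.mem_univ x
  have hnot : ξ ∉ lowerSpan e I ξ 1 := fun h => hξ0 <|
    eq_zero_of_mem_lowerSpan he hξ h (LowerMonomial.base.posOp_eq he hξ) fun N hN hEq => by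
      rw [Nat.cast_zero] at hEq
      have : (N : ℂ) = 0 := (add_left_cancel hEq).symm
      have := Nat.cast_eq_zero.mp this
      omega
  obtain ⟨φ, hφ, hle⟩ := Submodule.exists_le_ker_of_notMem hnot
  have hsplit : ∀ w, ∃ c : ℂ, w - c • ξ ∈ lowerSpan e I ξ 1 := by
    intro w
    have hw : w ∈ lowerSpan e I ξ 0 := htop ▸ Submodule.mem_top
    induction hw using Submodule.span_induction with
    | mem w h =>
      obtain ⟨N, hN, h⟩ := h
      cases h with
      | base => exact ⟨1, by rw [one_smul, sub_self]; exact zero_mem _⟩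
      | step x y N w hx hy hxy hw =>
        refine ⟨0, ?_⟩
        rw [zero_smul, sub_zero]
        exact Submodule.subset_span ⟨_, by omega, .step x y N w hx hy hxy hw⟩
    | zero => exact ⟨0, by simp⟩
    | add v w _ _ h1 h2 =>
      obtain ⟨c, hc⟩ := h1
      obtain ⟨d, hd⟩ := h2
      refine ⟨c + d, ?_⟩
      have := add_mem hc hd
      convert this using 1
      module
    | smul t w _ h =>
      obtain ⟨c, hc⟩ := h
      refine ⟨t * c, ?_⟩
      have := Submodule.smul_mem _ t hc
      convert this using 1
      module
  -- Diagonal operators preserve the part strictly below `ξ`, a complement of its line; hence the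
  -- functional is a weight vector.
  have hcartan : ∀ x w, w ∈ lowerSpan e I ξ 1 → e x x w ∈ lowerSpan e I ξ 1 := by
    intro x w hw
    induction hw using Submodule.span_induction with
    | mem w h =>
      obtain ⟨M, hM, h⟩ := h
      obtain ⟨t, ht⟩ := h.cartan_eq he hξ (hmem x)
      rw [ht]
      exact Submodule.smul_mem _ _ (Submodule.subset_span ⟨M, hM, h⟩)
    | zero => rw [map_zero]; exact zero_mem _
    | add v w _ _ h1 h2 => rw [map_add]; exact add_mem h1 h2
    | smul c w _ h => rw [map_smul]; exact Submodule.smul_mem _ _ h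
  have hφ0 : ∀ w ∈ lowerSpan e I ξ 1, φ w = 0 := fun w hw => hle hw
  refine ⟨(φ ξ)⁻¹ • φ, inv_mul_cancel₀ hφ, fun x _ y _ hxy => ?_, fun x _ => ?_⟩
  · ext w
    have hw : w ∈ lowerSpan e I ξ 0 := htop ▸ Submodule.mem_top
    have := hφ0 _ (lowerSpan_lower (hmem y) (hmem x) hxy hw)
    simp [this]
  · ext w
    obtain ⟨c, hc⟩ := hsplit w
    obtain ⟨v, hv⟩ : ∃ v, v = w - c • ξ := ⟨_, rfl⟩
    rw [← hv] at hc
    obtain rfl : w = v + c • ξ := by rw [hv]; abel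
    have h1 := hφ0 _ (hcartan x v hc)
    have h2 := hφ0 _ hc
    simp only [LinearMap.dualMap_apply, LinearMap.smul_apply, map_add, map_smul, h1, h2,
      hξ.weight x (hmem x), smul_eq_mul]
    ring

end Triangular

/-! ### One odd index: lowering and raising in `gl_{m|1}`. -/

section Level

variable {m n : ℕ} {W : Type*} [AddCommGroup W] [Module ℂ W]

/-- The indices of the subalgebra `gl_{m|1}` with odd index `a`. -/
def levelSet (m : ℕ) {n : ℕ} (a : Fin n) : Finset (Idx m n) :=
  insert (.inr a) (Finset.univ.image Sum.inl)

theorem inl_mem_levelSet (p : Fin m) (a : Fin n) : (.inl p : Idx m n) ∈ levelSet m a := by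
  simp [levelSet]

theorem inr_mem_levelSet (a : Fin n) : (.inr a : Idx m n) ∈ levelSet m a := by
  simp [levelSet]

/-- `w` lies in the module generated by the highest vector `ξ`, at height `c` below it. -/
def AtHeight (e : Idx m n → Idx m n → Module.End ℂ W) (I : Finset (Idx m n)) (lam : Idx m n → ℂ)
    (ξ : W) (c : ℤ) (w : W) : Prop :=
  w ∈ lowerSpan e I ξ 0 ∧ posOp e I w = ((∑ x ∈ I, (pos x : ℂ) * lam x) + c) • w

section AtHeight

variable {e : Idx m n → Idx m n → Module.End ℂ W} {I : Finset (Idx m n)} {lam : Idx m n → ℂ}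
  {ξ : W}

theorem AtHeight.add {c : ℤ} {v w : W} (hv : AtHeight e I lam ξ c v) (hw : AtHeight e I lam ξ c w) :
    AtHeight e I lam ξ c (v + w) :=
  ⟨add_mem hv.1 hw.1, by rw [map_add, hv.2, hw.2, smul_add]⟩

theorem AtHeight.smul {c : ℤ} {w : W} (hw : AtHeight e I lam ξ c w) (t : ℂ) :
    AtHeight e I lam ξ c (t • w) :=
  ⟨Submodule.smul_mem _ _ hw.1, by rw [map_smul, hw.2, smul_comm]⟩

theorem AtHeight.sum {ι : Type*} {c : ℤ} {s : Finset ι} {f : ι → W}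
    (h : ∀ i ∈ s, AtHeight e I lam ξ c (f i)) : AtHeight e I lam ξ c (∑ i ∈ s, f i) :=
  ⟨sum_mem fun i hi => (h i hi).1, by
    rw [map_sum, Finset.smul_sum]; exact Finset.sum_congr rfl fun i hi => (h i hi).2⟩

variable (he : IsRep e) (hξ : HighestOn e I lam ξ)

include he hξ

theorem AtHeight.self : AtHeight e I lam ξ 0 ξ :=
  ⟨self_mem_lowerSpan, by simpa using LowerMonomial.base.posOp_eq he hξ⟩

theorem AtHeight.apply {c d : ℤ} {w : W} (hw : AtHeight e I lam ξ c w) {x y : Idx m n}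
    (hx : x ∈ I) (hy : y ∈ I) (hd : d = c + pos x - pos y) : AtHeight e I lam ξ d (e x y w) := by
  refine ⟨lowerSpan_stable he hξ hw.1 hx hy, ?_⟩
  rw [posOp_apply he hx hy, hw.2, map_smul, hd]
  push_cast
  module

theorem AtHeight.eq_zero {c : ℤ} {w : W} (hw : AtHeight e I lam ξ c w) (hc : c < 0) : w = 0 := by
  refine eq_zero_of_mem_lowerSpan he hξ hw.1 hw.2 fun N _ h => ?_
  have h1 : (c : ℂ) = ((N : ℤ) : ℂ) := by simpa using h
  have := Int.cast_injective h1
  omega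

end AtHeight

/-- The product of the raising operators `e p a` over a list of even indices `p`. -/
def raiseList (e : Idx m n → Idx m n → Module.End ℂ W) (a : Fin n) : List (Fin m) → Module.End ℂ W
  | [] => 1
  | j :: s => raiseList e a s * e (.inl j) (.inr a)

/-- The height of the product of the lowering operators `e a q` over a list of even indices. -/
def height (a : Fin n) (s : List (Fin m)) : ℤ :=
  (s.map fun q : Fin m => (m : ℤ) + (a : ℕ) - (q : ℕ)).sum

variable {e : Idx m n → Idx m n → Module.End ℂ W} (he : IsRep e)

include he

theorem raiseList_comm (a : Fin n) {k : Fin m} {s : List (Fin m)} (hk : k ∉ s) (q : Fin m) (w : W) :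
    raiseList e a s (e (.inl q) (.inl k) w) = e (.inl q) (.inl k) (raiseList e a s w) := by
  induction s generalizing w with
  | nil => rfl
  | cons p s ih =>
    rw [List.mem_cons, not_or] at hk
    simp only [raiseList, Module.End.mul_apply]
    rw [← ih hk.2, he.even_raise, if_neg (Ne.symm hk.1), add_zero]

theorem raiseList_self (a : Fin n) {k : Fin m} {s : List (Fin m)} (hk : k ∈ s) (w : W) :
    raiseList e a s (e (.inl k) (.inr a) w) = 0 := by
  induction s generalizing w with
  | nil => simp at hk
  | cons p s ih =>
    simp only [raiseList, Module.End.mul_apply]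
    rcases eq_or_ne k p with rfl | h
    · rw [he.raise_raise_self, map_zero]
    · rw [he.raise_raise, map_neg, ih ((List.mem_cons.mp hk).resolve_left h), neg_zero]

variable {a : Fin n} {lam : Idx m n → ℂ} {ξ : W} (hξ : HighestOn e (levelSet m a) lam ξ)

include hξ

theorem AtHeight.raiseList {c d : ℤ} {s : List (Fin m)} {w : W}
    (hw : AtHeight e (levelSet m a) lam ξ c w) (hd : d = c - height a s) :
    AtHeight e (levelSet m a) lam ξ d (raiseList e a s w) := by
  induction s generalizing c w with
  | nil => simpa [GLSuper.raiseList, hd, height] using hw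
  | cons p s ih =>
    refine ih (hw.apply he hξ (inl_mem_levelSet p a) (inr_mem_levelSet a) rfl) ?_
    simp only [hd, height, List.map_cons, List.sum_cons, pos]
    push_cast
    ring

theorem AtHeight.lowerEnd {c d : ℤ} (t : Fin m → ℂ) {k : Fin m} {w : W}
    (hw : AtHeight e (levelSet m a) lam ξ c w) (hd : d = c + (m + (a : ℕ)) - (k : ℕ)) :
    AtHeight e (levelSet m a) lam ξ d (lowerEnd e a t k w) := by
  induction k using WellFoundedGT.induction generalizing d with
  | ind k ih =>
    rw [lowerEnd_apply]
    refine (hw.apply he hξ (inr_mem_levelSet a) (inl_mem_levelSet k a) ?_).add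
      (AtHeight.sum fun k' hk' => AtHeight.smul ((ih k' (Finset.mem_Ioi.mp hk') rfl).apply he hξ
        (inl_mem_levelSet k' a) (inl_mem_levelSet k a) ?_) _)
    · simp [hd, pos]
    · simp only [hd, pos]; ring

/-- Moving `E_{ak}` left past each `E_{pa}` leaves a term `E_{pk} E_{ka} θ`. For `p < k` it equals
`E_{pa} θ` and adds one to the count; for `p > k` it dies because its height would be negative. -/
theorem raiseList_lower_raise {k : Fin m} {s : List (Fin m)} (hs : s.Nodup) (hk : k ∉ s) {θ : W}
    (hθ : AtHeight e (levelSet m a) lam ξ (height a s) θ)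
    (h0 : ∀ q ∈ s, q < k → e (.inl q) (.inl k) θ = 0) :
    raiseList e a s (e (.inr a) (.inl k) (e (.inl k) (.inr a) θ)) =
      ((s.toFinset.filter (· < k)).card : ℂ) • raiseList e a s θ := by
  have hIk := inl_mem_levelSet k a
  have hIa : (.inr a : Idx m n) ∈ levelSet m a := inr_mem_levelSet a
  have hka := k.isLt
  induction s generalizing θ with
  | nil =>
    rw [(hθ.apply he hξ hIk hIa rfl).eq_zero he hξ (by simp only [height, pos]; simp; omega)]
    simp
  | cons p s ih =>
    rw [List.mem_cons, not_or] at hk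
    rw [List.nodup_cons] at hs
    have hp := inl_mem_levelSet p a
    have h1 := ih hs.2 hk.2 (θ := e (.inl p) (.inr a) θ) (hθ.apply he hξ hp hIa (by
        simp only [height, List.map_cons, List.sum_cons, pos]; push_cast; ring)) (by
      intro q hq hqk
      rw [he.even_raise, h0 q (List.mem_cons_of_mem _ hq) hqk, map_zero, if_neg (Ne.symm hk.1),
        add_zero])
    simp only [raiseList, Module.End.mul_apply]
    rw [he.raise_lower, if_pos rfl, if_neg (Ne.symm hk.1), add_zero, he.raise_raise, map_neg,
      neg_neg, map_add, h1, List.toFinset_cons, Finset.filter_insert]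
    rcases lt_or_gt_of_ne (Ne.symm hk.1) with h | h
    · rw [if_pos h, Finset.card_insert_of_notMem (by simp [hs.1]), he.even_raise, if_pos rfl,
        h0 p List.mem_cons_self h, map_zero, zero_add, Nat.cast_add, Nat.cast_one, add_smul,
        one_smul]
    · have hz : raiseList e a s (e (.inl k) (.inr a) θ) = 0 :=
        ((hθ.apply he hξ hIk hIa rfl).raiseList he hξ rfl).eq_zero he hξ (by
          rw [Fin.lt_def] at h
          simp only [height, List.map_cons, List.sum_cons, pos]; push_cast; omega)
      rw [if_neg h.not_gt, raiseList_comm he a hk.2, hz, map_zero, add_zero]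

/-- In `E_{ka} E_{k'k} = E_{k'k} E_{ka} - E_{k'a}` the first product contributes nothing by height.
The second vanishes when `k' ∈ s`, since then `E_{k'a}` occurs twice. -/
theorem raiseList_raise_lowerEnd_rec {k : Fin m} {s : List (Fin m)} (hs : s.Nodup) (hk : k ∉ s)
    {θ : W} (hθ : AtHeight e (levelSet m a) lam ξ (height a s) θ) {g : Fin m → ℂ} {τ : ℂ}
    (hsing : Sing e g θ) (hτ : e (.inr a) (.inr a) θ = τ • θ) (c : Fin m → ℂ) :
    raiseList e a s (e (.inl k) (.inr a) (lowerEnd e a c k θ)) =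
      (g k + τ - (s.toFinset.filter (· < k)).card : ℂ) • raiseList e a s θ -
      ∑ k' ∈ (Finset.Ioi k).filter (· ∉ s),
        (c k')⁻¹ • raiseList e a s (e (.inl k') (.inr a) (lowerEnd e a c k' θ)) := by
  have hIk := inl_mem_levelSet k a
  have hIa : (.inr a : Idx m n) ∈ levelSet m a := inr_mem_levelSet a
  have hterm : ∀ k' ∈ Finset.Ioi k, raiseList e a s (e (.inl k) (.inr a)
      ((c k')⁻¹ • e (.inl k') (.inl k) (lowerEnd e a c k' θ))) =
      -if k' ∉ s then (c k')⁻¹ •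
        raiseList e a s (e (.inl k') (.inr a) (lowerEnd e a c k' θ)) else 0 := by
    intro k' hk'
    have hlt := Finset.mem_Ioi.mp hk'
    have h1 := he.even_raise k' k k a (lowerEnd e a c k' θ)
    rw [if_pos rfl] at h1
    have hz : raiseList e a s (e (.inl k) (.inr a) (lowerEnd e a c k' θ)) = 0 :=
      (((hθ.lowerEnd he hξ c rfl).apply he hξ hIk hIa rfl).raiseList he hξ rfl).eq_zero he hξ (by
        rw [Fin.lt_def] at hlt
        simp only [pos]; push_cast; omega)
    rw [map_smul, map_smul, ← sub_eq_iff_eq_add.mpr h1, map_sub, raiseList_comm he a hk, hz,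
      map_zero, zero_sub, smul_neg]
    by_cases h : k' ∈ s
    · rw [raiseList_self he a h, smul_zero, if_neg (not_not.mpr h)]
    · rw [if_pos h]
  rw [lowerEnd_apply, map_add, map_sum, map_add, map_sum, Finset.sum_congr rfl hterm,
    Finset.sum_neg_distrib, ← Finset.sum_filter, ← sub_eq_add_neg]
  congr 1
  rw [he.raise_lower, if_pos rfl, if_pos rfl, map_add, map_add, map_neg,
    raiseList_lower_raise he hξ hs hk hθ fun q _ h => hsing.raising q k h, hsing.weight, hτ,
    map_smul, map_smul]
  module

omit [AddCommGroup W] [Module ℂ W] he hξ in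
theorem sum_mul_prod_one_sub {α : Type*} [LinearOrder α] (d : α → ℂ) (F : Finset α) :
    ∑ k ∈ F, d k * ∏ j ∈ F.filter (k < ·), (1 - d j) = 1 - ∏ j ∈ F, (1 - d j) := by
  induction F using Finset.induction_on_min with
  | empty => simp
  | insert b F hb ih =>
    have hbF : b ∉ F := fun h => lt_irrefl _ (hb b h)
    have h1 : ∀ k ∈ F, d k * ∏ j ∈ (insert b F).filter (k < ·), (1 - d j) =
        d k * ∏ j ∈ F.filter (k < ·), (1 - d j) := fun k hk => by
      rw [Finset.filter_insert, if_neg (hb k hk).not_gt]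
    rw [Finset.sum_insert hbF, Finset.prod_insert hbF, Finset.sum_congr rfl h1, ih,
      Finset.filter_insert, if_neg (lt_irrefl b), Finset.filter_true_of_mem hb]
    ring

omit [AddCommGroup W] [Module ℂ W] he hξ in
theorem card_complement {k : Fin m} {s : List (Fin m)} (hs : s.Nodup) (hk : k ∉ s) :
    ((Finset.Ioi k).filter (· ∉ s)).card + k + 1 + s.length =
      m + (s.toFinset.filter (· < k)).card := by
  have h1 := Finset.card_filter_add_card_filter_not (s := Finset.Ioi k) (· ∈ s)
  have h2 := Finset.card_filter_add_card_filter_not (s := s.toFinset) (· < k)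
  have h3 : s.toFinset.filter (fun x => ¬ x < k) = (Finset.Ioi k).filter (· ∈ s) := by
    ext x
    simp only [Finset.mem_filter, List.mem_toFinset, Finset.mem_Ioi, not_lt]
    exact ⟨fun ⟨h, h'⟩ => ⟨lt_of_le_of_ne h' fun hh => hk (hh ▸ h), h⟩, fun ⟨h, h'⟩ => ⟨h', h.le⟩⟩
  rw [Fin.card_Ioi] at h1
  rw [h3, List.toFinset_card_of_nodup hs] at h2
  have := k.isLt
  omega

/-- This solves the recursion: the products telescope by `sum_mul_prod_one_sub`, and the terms `-1`
are counted by `card_complement`. At the index where `c k = 0` only the product remains. -/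
theorem raiseList_raise_lowerEnd {k : Fin m} {s : List (Fin m)} (hs : s.Nodup) (hk : k ∉ s)
    {θ : W} (hθ : AtHeight e (levelSet m a) lam ξ (height a s) θ) {g : Fin m → ℂ} {κ u : ℂ}
    (hsing : Sing e g θ) (hκ : e (.inr a) (.inr a) θ = (κ + s.length) • θ) {c : Fin m → ℂ}
    (hc : ∀ k, c k = u - (g k - (k : ℕ))) (hc0 : ∀ k', k < k' → k' ∉ s → c k' ≠ 0) :
    raiseList e a s (e (.inl k) (.inr a) (lowerEnd e a c k θ)) =
      (-c k + (u + (κ + m - 1)) * ∏ k' ∈ (Finset.Ioi k).filter (· ∉ s), (1 - (c k')⁻¹)) •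
        raiseList e a s θ := by
  induction k using WellFoundedGT.induction with
  | ind k ih =>
    have hfil : ∀ k' ∈ (Finset.Ioi k).filter (· ∉ s), (Finset.Ioi k').filter (· ∉ s) =
        ((Finset.Ioi k).filter (· ∉ s)).filter (k' < ·) := by
      intro k' hk'
      ext x
      simp only [Finset.mem_Ioi, Finset.mem_filter] at hk' ⊢
      exact ⟨fun h => ⟨⟨hk'.1.trans h.1, h.2⟩, h.1⟩, fun h => ⟨h.2, h.1.2⟩⟩
    have hterm : ∀ k' ∈ (Finset.Ioi k).filter (· ∉ s),
        (c k')⁻¹ • raiseList e a s (e (.inl k') (.inr a) (lowerEnd e a c k' θ)) =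
        (-1 + (u + (κ + m - 1)) * ((c k')⁻¹ *
          ∏ j ∈ ((Finset.Ioi k).filter (· ∉ s)).filter (k' < ·), (1 - (c j)⁻¹))) •
            raiseList e a s θ := by
      intro k' hk'
      have hk2 := Finset.mem_filter.mp hk'
      have hlt := Finset.mem_Ioi.mp hk2.1
      rw [ih k' hlt hk2.2 fun j hj => hc0 j (hlt.trans hj), hfil k' hk', smul_smul]
      congr 1
      field_simp [hc0 k' hlt hk2.2]
    rw [raiseList_raise_lowerEnd_rec he hξ hs hk hθ hsing hκ, Finset.sum_congr rfl hterm,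
      ← Finset.sum_smul, ← sub_smul, Finset.sum_add_distrib, ← Finset.mul_sum,
      sum_mul_prod_one_sub, hc k]
    congr 1
    have hcard := congrArg (Nat.cast : ℕ → ℂ) (card_complement hs hk)
    push_cast at hcard
    simp only [Finset.sum_const, nsmul_eq_mul]
    linear_combination hcard

/-- Lowering a highest vector of `gl_{m|1}` at a set of even indices. -/
theorem exists_level {ν : Fin m → ℕ} {κ : ℕ} (hν : ∀ p, lam (.inl p) = ν p)
    (hκ : lam (.inr a) = κ) {s : List (Fin m)} (hs : s.Pairwise (· < ·))
    (hpos : ∀ j ∈ s, 1 ≤ ν j) (hle : ∀ j ∈ s, ∀ k, j < k → ν k ≤ ν j)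
    (hlt : ∀ j ∈ s, ∀ k, j < k → k ∉ s → ν k + 1 ≤ ν j) :
    ∃ θ : W, Sing e (fun p => (ν p : ℂ) - if p ∈ s then 1 else 0) θ ∧
      (∃ C : ℂ, C ≠ 0 ∧ raiseList e a s θ = C • ξ) ∧
      (∀ D : Submodule ℂ W, (∀ x ∈ levelSet m a, ∀ y ∈ levelSet m a, ∀ w ∈ D, e x y w ∈ D) →
        ξ ∈ D → θ ∈ D) ∧
      e (.inr a) (.inr a) θ = ((κ : ℂ) + s.length) • θ ∧
      AtHeight e (levelSet m a) lam ξ (height a s) θ := by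
  have hIk := fun k => inl_mem_levelSet (m := m) k a
  have hIa : (.inr a : Idx m n) ∈ levelSet m a := inr_mem_levelSet a
  induction s with
  | nil =>
    refine ⟨ξ, ⟨fun p q h => hξ.raising _ (hIk p) _ (hIk q) h, fun p => ?_⟩,
      ⟨1, one_ne_zero, by simp [raiseList]⟩, fun D _ h => h, ?_, ?_⟩
    · rw [hξ.weight _ (hIk p), hν]; simp
    · rw [hξ.weight _ hIa, hκ]; simp
    · exact AtHeight.self he hξ
  | cons j s ih =>
    rw [List.pairwise_cons] at hs
    have hj : j ∉ s := fun h => lt_irrefl _ (hs.1 j h)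
    obtain ⟨θ, hsing, ⟨C, hC, hR⟩, hD, ha, hθ⟩ := ih hs.2
      (fun i hi => hpos i (List.mem_cons_of_mem _ hi))
      (fun i hi => hle i (List.mem_cons_of_mem _ hi))
      (fun i hi k hik hk => hlt i (List.mem_cons_of_mem _ hi) k hik (by
        rw [List.mem_cons, not_or]
        exact ⟨((hs.1 i hi).trans hik).ne', hk⟩))
    obtain ⟨c, hc⟩ : ∃ c : Fin m → ℂ, ∀ k, c k = ((ν j : ℂ) - (if j ∈ s then 1 else 0) - (j : ℕ)) -
      ((ν k : ℂ) - (if k ∈ s then 1 else 0) - (k : ℕ)) := ⟨_, fun _ => rfl⟩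
    have hcnat : ∀ k, j < k → ∃ N : ℕ, 1 ≤ N ∧ c k = N ∧ (k ∉ s → N ≠ 1) := by
      intro k hk
      have h1 := hle j List.mem_cons_self k hk
      rw [Fin.lt_def] at hk
      -- For `k ∉ s` both `ν j - ν k` and `k - j` are at least one, so `c k ≥ 2` and `1 - (c k)⁻¹`
      -- is nonzero.
      refine ⟨(ν j - ν k) + (k - j) + if k ∈ s then 1 else 0, by omega, ?_, fun hks => ?_⟩
      · rw [hc, if_neg hj]
        push_cast [h1, hk.le]
        ring
      · have := hlt j List.mem_cons_self k hk (by
          rw [List.mem_cons, not_or]; exact ⟨by rintro rfl; exact lt_irrefl _ hk, hks⟩)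
        omega
    have hc0 : ∀ k, j < k → c k ≠ 0 := by
      intro k hk
      obtain ⟨N, hN, h, -⟩ := hcnat k hk
      rw [h, Nat.cast_ne_zero]
      omega
    have hc1 : ∀ k, j < k → k ∉ s → 1 - (c k)⁻¹ ≠ 0 := by
      intro k hk hks h0
      obtain ⟨N, hN, h, h1⟩ := hcnat k hk
      rw [sub_eq_zero, eq_comm, inv_eq_one, h] at h0
      exact h1 hks (by exact_mod_cast h0)
    refine ⟨lowerEnd e a c j θ, ?_, ?_, ?_, ?_, ?_⟩
    · have := hsing.lowerEnd he a hc hc0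
      convert this using 2 with p
      rcases eq_or_ne p j with rfl | h
      · simp [hj]
      · simp [h]
    · refine ⟨((((ν j : ℂ) - (if j ∈ s then 1 else 0) - (j : ℕ)) + (κ + m - 1)) *
        ∏ k ∈ (Finset.Ioi j).filter (· ∉ s), (1 - (c k)⁻¹)) * C, mul_ne_zero (mul_ne_zero ?_
          (Finset.prod_ne_zero_iff.mpr fun k hk => hc1 k (Finset.mem_Ioi.mp
            (Finset.mem_filter.mp hk).1) (Finset.mem_filter.mp hk).2)) hC, ?_⟩
      · have h1 := hpos j List.mem_cons_self
        have h2 := j.isLt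
        -- The factor is a natural number, positive because `ν j ≥ 1`.
        have h3 : ((ν j : ℂ) - (if j ∈ s then 1 else 0) - (j : ℕ)) + (κ + m - 1) =
            ((ν j + κ + (m - 1 - j) : ℕ) : ℂ) := by
          rw [if_neg hj, Nat.sub_sub]
          push_cast [show 1 + (j : ℕ) ≤ m by omega]
          ring
        rw [h3, Nat.cast_ne_zero]
        omega
      · have hnd : s.Nodup := hs.2.imp fun h => h.ne
        simp only [raiseList, Module.End.mul_apply]
        rw [raiseList_raise_lowerEnd he hξ hnd hj hθ hsing ha hc fun k hk _ => hc0 k hk, hR,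
          smul_smul, show c j = 0 by rw [hc, sub_self]]
        simp
    · intro D hst hD0
      exact lowerEnd_mem a c (fun p _ w hw => hst _ hIa _ (hIk p) w hw)
        (fun p q _ _ w hw => hst _ (hIk q) _ (hIk p) w hw) (hD D hst hD0)
    · rw [lowerEnd_weight he a c j _ ha]
      congr 1
      simp [add_assoc]
    · refine hθ.lowerEnd he hξ c ?_
      simp only [height, List.map_cons, List.sum_cons]
      ring

end Level

/-! ### Iteration over the odd indices. -/

section Tower

variable {m n : ℕ} {W : Type*} [AddCommGroup W] [Module ℂ W]

/-- The product of the odd raising operators `e j a` over a list of pairs `(a, j)`. -/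
def raisePairs (e : Idx m n → Idx m n → Module.End ℂ W) (w : List (Fin n × Fin m)) :
    Module.End ℂ W :=
  (w.map fun x => e (.inl x.2) (.inr x.1)).prod

theorem raisePairs_append (e : Idx m n → Idx m n → Module.End ℂ W) (v w : List (Fin n × Fin m)) :
    raisePairs e (v ++ w) = raisePairs e v * raisePairs e w := by
  simp [raisePairs]

theorem raiseList_eq (e : Idx m n → Idx m n → Module.End ℂ W) (a : Fin n) (s : List (Fin m)) :
    raiseList e a s = raisePairs e (s.reverse.map (Prod.mk a)) := by
  induction s with
  | nil => rfl
  | cons j s ih =>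
    rw [raiseList, ih, List.reverse_cons, List.map_append, raisePairs_append]
    simp [raisePairs]

/-- The vectors of odd weight `κ` killed by all `e x b` with `x < b`, for the odd indices `b` from
the `t`-th on. -/
def oddHighest (e : Idx m n → Idx m n → Module.End ℂ W) (κ : Fin n → ℂ) (t : ℕ) :
    Submodule ℂ W where
  carrier := {w | ∀ b : Fin n, t ≤ b → (∀ x, pos x < m + b → e x (.inr b) w = 0) ∧
    e (.inr b) (.inr b) w = κ b • w}
  add_mem' := fun {v w} hv hw b hb => ⟨fun x hx => by
    rw [map_add, (hv b hb).1 x hx, (hw b hb).1 x hx, add_zero], by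
    rw [map_add, (hv b hb).2, (hw b hb).2, smul_add]⟩
  zero_mem' := fun b _ => ⟨fun x _ => map_zero _, by rw [map_zero, smul_zero]⟩
  smul_mem' := fun c w hw b hb => ⟨fun x hx => by
    rw [map_smul, (hw b hb).1 x hx, smul_zero], by rw [map_smul, (hw b hb).2, smul_comm]⟩

theorem oddHighest_mono (e : Idx m n → Idx m n → Module.End ℂ W) (κ : Fin n → ℂ) (t : ℕ) :
    oddHighest e κ t ≤ oddHighest e κ (t + 1) :=
  fun _ hw b hb => hw b (by omega)

variable {e : Idx m n → Idx m n → Module.End ℂ W} (he : IsRep e)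

include he

/-- The commutator of `E_{xb}` with `E_{pq}` is at most a multiple of `E_{pb}`, and `p` precedes
`b`. Thus work at level `a` keeps the vector highest for all later levels. -/
theorem oddHighest_stable {κ : Fin n → ℂ} (a : Fin n) {p q : Idx m n} (hp : p ∈ levelSet m a)
    (hq : q ∈ levelSet m a) {w : W} (hw : w ∈ oddHighest e κ (a + 1)) :
    e p q w ∈ oddHighest e κ (a + 1) := by
  have hlt : ∀ x ∈ levelSet m a, ∀ b : Fin n, (a : ℕ) + 1 ≤ b → pos x < m + b := by
    intro x hx b hb
    rcases x with i | c
    · simp only [pos]; omega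
    · have : c = a := by simpa [levelSet] using hx
      subst this
      simp only [pos]; omega
  intro b hb
  have hpb := hlt p hp b hb
  have hqb := hlt q hq b hb
  have hpn : p ≠ .inr b := fun h => by rw [h] at hpb; simp [pos] at hpb
  have hqn : q ≠ .inr b := fun h => by rw [h] at hqb; simp [pos] at hqb
  refine ⟨fun x hx => ?_, ?_⟩
  · have := he x (.inr b) p q w
    rw [(hw b hb).1 x hx, (hw b hb).1 p hpb, if_neg hpn] at this
    simpa using this
  · rw [he.cartan, (hw b hb).2, if_neg hpn.symm, if_neg hqn.symm]
    simp

/-- Level `t` subtracts one from each even entry still above its target `mu`. An entry outside the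
chosen set already equals `mu`, so monotonicity of `mu` gives the strict inequality `exists_level`
requires. -/
theorem exists_tower {lam : Idx m n → ℕ} {ξ : W}
    (hξ : HighestOn e Finset.univ (fun x => (lam x : ℂ)) ξ)
    (hlam : Antitone fun i : Fin m => lam (.inl i)) {mu : Fin m → ℕ} (hmu : Antitone mu)
    (hle : ∀ i, mu i ≤ lam (.inl i)) (t : ℕ) (ht : t ≤ n) :
    ∃ φ : W, Sing e (fun p => ((max (lam (.inl p) - t) (mu p) : ℕ) : ℂ)) φ ∧
      φ ∈ oddHighest e (fun b => (lam (.inr b) : ℂ)) t ∧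
      ∃ w : List (Fin n × Fin m), w.Nodup ∧
        (∀ x, x ∈ w ↔ (x.1 : ℕ) < t ∧ (x.1 : ℕ) < lam (.inl x.2) - mu x.2) ∧
        ∃ C : ℂ, C ≠ 0 ∧ raisePairs e w φ = C • ξ := by
  induction t with
  | zero =>
    refine ⟨ξ, ⟨fun p q h => hξ.raising _ (Finset.mem_univ _) _ (Finset.mem_univ _) h, fun p => ?_⟩,
      fun b _ => ⟨fun x hx => hξ.raising _ (Finset.mem_univ _) _ (Finset.mem_univ _) hx,
        hξ.weight _ (Finset.mem_univ _)⟩, [], List.nodup_nil, by simp, 1, one_ne_zero,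
      by simp [raisePairs]⟩
    rw [hξ.weight _ (Finset.mem_univ _), Nat.sub_zero, max_eq_left (hle p)]
  | succ t ih =>
    obtain ⟨φ, hsing, hodd, w, hnd, hmem, C, hC, hφ⟩ := ih (by omega)
    obtain ⟨a, ha⟩ : ∃ a : Fin n, (a : ℕ) = t := ⟨⟨t, ht⟩, rfl⟩
    obtain ⟨s, hs⟩ : ∃ s : List (Fin m),
      s = (Finset.univ.filter fun j : Fin m => t < lam (.inl j) - mu j).sort (· ≤ ·) := ⟨_, rfl⟩
    have hsmem : ∀ j, j ∈ s ↔ t < lam (.inl j) - mu j := fun j => by simp [hs]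
    have hsorted : s.Pairwise (· < ·) := by
      rw [hs]; exact Finset.sortedLT_sort _ |>.pairwise
    have hIlam : HighestOn e (levelSet m a) (Sum.elim
        (fun p => ((max (lam (.inl p) - t) (mu p) : ℕ) : ℂ)) fun b => (lam (.inr b) : ℂ)) φ := by
      refine ⟨fun x hx y hy hxy => ?_, fun x hx => ?_⟩
      · rcases y with q | b
        · rcases x with p | c
          · exact hsing.raising p q hxy
          · simp only [pos] at hxy; omega
        · have : b = a := by simpa [levelSet] using hy
          exact (hodd b (by rw [this, ha])).1 x hxy
      · rcases x with p | b
        · exact hsing.weight p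
        · have : b = a := by simpa [levelSet] using hx
          exact (hodd b (by rw [this, ha])).2
    obtain ⟨θ, hθ, ⟨C', hC', hR⟩, hD, -⟩ := exists_level he hIlam
      (ν := fun p => max (lam (.inl p) - t) (mu p)) (κ := lam (.inr a)) (fun _ => rfl) rfl hsorted
      (fun j hj => by have := (hsmem j).mp hj; omega)
      (fun j hj k hk => by have := hlam hk.le; have := hmu hk.le; dsimp only at *; omega)
      (fun j hj k hk hks => by
        have := (hsmem j).mp hj
        rw [hsmem] at hks
        have := hmu hk.le
        have := hlam hk.le
        dsimp only at *
        omega)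
    refine ⟨θ, ?_, ?_, w ++ s.reverse.map (Prod.mk a), ?_, ?_, C' * C, mul_ne_zero hC' hC, ?_⟩
    · convert hθ using 2 with p
      have h1 := hsmem p
      have h2 := hle p
      by_cases hp : p ∈ s
      · rw [if_pos hp, eq_sub_iff_add_eq]
        have := h1.mp hp
        norm_cast
        omega
      · rw [if_neg hp, sub_zero]
        rw [h1] at hp
        congr 1
        omega
    · have h1 := oddHighest_mono _ _ _ hodd
      rw [← ha] at h1 ⊢
      exact hD _ (fun x hx y hy w hw => oddHighest_stable he a hx hy hw) h1
    · refine List.nodup_append.mpr ⟨hnd, (List.nodup_reverse.mpr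
        (hsorted.imp fun h => h.ne)).map (Prod.mk_right_injective a), ?_⟩
      rintro x hx y hy rfl
      obtain ⟨j, -, rfl⟩ := List.mem_map.mp hy
      have := ((hmem _).mp hx).1
      simp only at this
      omega
    · rintro ⟨b, j⟩
      have hb : (b, j) ∈ s.reverse.map (Prod.mk a) ↔ t < lam (.inl j) - mu j ∧ (b : ℕ) = t := by
        rw [← hsmem, ← ha, ← Fin.ext_iff]
        simp [eq_comm]
      rw [List.mem_append, hmem, hb]
      dsimp only
      omega
    · rw [raisePairs_append, Module.End.mul_apply, ← raiseList_eq, hR, map_smul, hφ, smul_smul]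

/-- Odd raising operators anticommute. -/
theorem raisePairs_perm {v w : List (Fin n × Fin m)} (h : v.Perm w) (x : W) :
    raisePairs e v x = raisePairs e w x ∨ raisePairs e v x = -raisePairs e w x := by
  induction h generalizing x with
  | nil => exact Or.inl rfl
  | cons a h ih =>
    simp only [raisePairs, List.map_cons, List.prod_cons, Module.End.mul_apply] at ih ⊢
    rcases ih x with h | h
    · exact Or.inl (by rw [h])
    · exact Or.inr (by rw [h, map_neg])
  | swap a b l =>
    refine Or.inr ?_
    simp only [raisePairs, List.map_cons, List.prod_cons, Module.End.mul_apply]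
    exact he.raise_raise _ _ _ _ _
  | trans _ _ h1 h2 =>
    rcases h1 x with h1 | h1 <;> rcases h2 x with h2 | h2 <;> rw [h1, h2]
    · exact Or.inl rfl
    · exact Or.inr rfl
    · exact Or.inr rfl
    · exact Or.inl (neg_neg _)

end Tower

/-! ### Action of the enveloping algebra and the products of `zLower`. -/

section Module

variable {m n : ℕ} {L : Type*} [AddCommGroup L] [Module ℂ L] [Module (U m n) L]
  [IsScalarTower ℂ (U m n) L]

variable (L) in
/-- The operator of the standard basis element `E_{ij}` on a module. -/
noncomputable def actE (i j : Idx m n) : Module.End ℂ L :=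
  Algebra.lsmul ℂ ℂ L (E i j : U m n)

theorem actE_apply (i j : Idx m n) (w : L) : actE L i j w = (E i j : U m n) • w := rfl

theorem isRep_actE : IsRep (actE L : Idx m n → Idx m n → Module.End ℂ L) := by
  intro i j k l w
  have h := RingQuot.mkAlgHom_rel ℂ (Rel.comm (m := m) (n := n) i j k l)
  simp only [map_sub, map_mul, map_smul] at h
  have h2 := congrArg (fun x : U m n => x • w) h
  simp only [sub_smul, mul_smul, smul_assoc] at h2
  simp only [actE_apply]
  refine h2.trans ?_
  congr 1
  · split_ifs
    · rfl
    · rw [map_zero, zero_smul]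
  · split_ifs
    · rw [map_smul, smul_assoc]; rfl
    · rw [map_zero, zero_smul]

theorem lowerChain_smul (a : Fin n) (i : Fin m) (l : List (Fin m)) (w : L) :
    (lowerChain a i l : U m n) • w = chainEnd (actE L) a i l w := by
  induction l generalizing i with
  | nil => rfl
  | cons k l ih => rw [lowerChain, mul_smul, ih]; rfl

theorem h_sub_smul {f : Fin m → ℂ} {w : L} (hw : Sing (actE L : Idx m n → _) f w) (i j : Fin m) :
    ((h i - h j : U m n)) • w = ((f i - (i : ℕ)) - (f j - (j : ℕ))) • w := by
  have hh : ∀ i : Fin m, (h i : U m n) • w = (f i - (i : ℕ)) • w := fun i => by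
    rw [h, sub_smul, ← actE_apply, hw.weight, algebraMap_smul, sub_smul]
  rw [sub_smul, hh, hh, ← sub_smul]

theorem prod_h_sub_smul {f : Fin m → ℂ} {w : L} (hw : Sing (actE L : Idx m n → _) f w) (i : Fin m)
    (s : List (Fin m)) : ((s.map fun j => (h i - h j : U m n)).prod) • w =
      ((s.map fun j => (f i - (i : ℕ)) - (f j - (j : ℕ))).prod) • w := by
  induction s with
  | nil => simp
  | cons j s ih =>
    rw [List.map_cons, List.prod_cons, mul_smul, ih, List.map_cons, List.prod_cons, smul_comm,
      h_sub_smul hw, smul_smul, mul_comm]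

/-- On a singular vector the factors `h i - h j` act by the scalars `c j`; dividing by the full
product turns those over the complement of `S` into inverses over `S`. -/
theorem zLower_smul {f : Fin m → ℂ} {w : L} (hw : Sing (actE L : Idx m n → _) f w) (a : Fin n)
    {i : Fin m} {c : Fin m → ℂ} (hc : ∀ k, c k = (f i - (i : ℕ)) - (f k - (k : ℕ)))
    (hc0 : ∀ k, i < k → c k ≠ 0) : (zLower a i : U m n) • w =
      (∏ k ∈ Finset.Ioi i, c k) • lowerEnd (actE L) a c i w := by
  rw [zLower, lowerEnd, Finset.sum_smul, LinearMap.sum_apply, Finset.smul_sum]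
  refine Finset.sum_congr rfl fun S hS => ?_
  have hS := Finset.mem_powerset.mp hS
  rw [mul_smul, prod_h_sub_smul hw, smul_comm, lowerChain_smul, LinearMap.smul_apply, smul_smul]
  congr 1
  simp only [← hc]
  rw [← List.prod_toFinset _ (Finset.sort_nodup _ _), Finset.sort_toFinset,
    ← Finset.prod_sdiff hS, mul_assoc, ← Finset.prod_mul_distrib,
    Finset.prod_eq_one fun k hk => mul_inv_cancel₀ (hc0 k (Finset.mem_Ioi.mp (hS hk))), mul_one]

/-- The product of lowering operators `z_{aj}` over a list of pairs `(a, j)`. -/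
noncomputable def zPairs (w : List (Fin n × Fin m)) : U m n :=
  (w.map fun x => zLower x.1 x.2).prod

/-- The product of the operators `e a j` over a list of pairs `(a, j)`. -/
def lowerPairs {W : Type*} [AddCommGroup W] [Module ℂ W] (e : Idx m n → Idx m n → Module.End ℂ W)
    (w : List (Fin n × Fin m)) : Module.End ℂ W :=
  (w.map fun x => e (.inr x.1) (.inl x.2)).prod

theorem raisePairs_dual {W : Type*} [AddCommGroup W] [Module ℂ W]
    (e : Idx m n → Idx m n → Module.End ℂ W) (w : List (Fin n × Fin m)) (φ : Module.Dual ℂ W)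
    (v : W) : raisePairs (fun i j => (e j i).dualMap) w φ v = φ (lowerPairs e w.reverse v) := by
  induction w generalizing v with
  | nil => rfl
  | cons x w ih =>
    rw [List.reverse_cons, lowerPairs, List.map_append, List.prod_append, Module.End.mul_apply,
      ← lowerPairs, ← ih]
    simp [raisePairs]

/-- The hypothesis on suffixes keeps the weight at `i` strictly above those at all `k > i` when
`z_{ai}` is applied, so no `c k` vanishes. -/
theorem zPairs_smul {v : L} {f : Fin m → ℕ} (hv : Sing (actE L : Idx m n → _) (fun p => f p) v)
    {w : List (Fin n × Fin m)} (hw : w.Pairwise fun x y => x.2 ≤ y.2)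
    (hsuf : ∀ a i t, (a, i) :: t <:+ w → ∀ k, i < k →
      f k + (t.map Prod.snd).count i + 1 ≤ f i + (t.map Prod.snd).count k) :
    Sing (actE L : Idx m n → _) (fun p => (f p : ℂ) - ((w.map Prod.snd).count p : ℕ))
      ((zPairs w : U m n) • v) ∧
    ∀ i₀ : Fin m, (∀ x ∈ w, i₀ ≤ x.2) → ∀ ψ : Module.Dual ℂ L,
      (∀ k l : Fin m, i₀ ≤ l → l < k → ∀ y, ψ (actE L (.inl k : Idx m n) (.inl l) y) = 0) →
      ∃ C : ℂ, C ≠ 0 ∧ ψ ((zPairs w : U m n) • v) = C * ψ (lowerPairs (actE L) w v) := by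
  have he := isRep_actE (m := m) (n := n) (L := L)
  induction w with
  | nil =>
    refine ⟨by simpa [zPairs] using hv, fun _ _ ψ _ => ⟨1, one_ne_zero, ?_⟩⟩
    simp [zPairs, lowerPairs]
  | cons x t ih =>
    obtain ⟨a, i⟩ := x
    rw [List.pairwise_cons] at hw
    obtain ⟨hsing, hψ⟩ := ih hw.2 fun b j s hs => hsuf b j s (hs.trans (List.suffix_cons _ _))
    obtain ⟨c, hc⟩ : ∃ c : Fin m → ℂ, ∀ k, c k =
      (((f i : ℂ) - ((t.map Prod.snd).count i : ℕ)) - (i : ℕ)) -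
      (((f k : ℂ) - ((t.map Prod.snd).count k : ℕ)) - (k : ℕ)) := ⟨_, fun _ => rfl⟩
    have hc0 : ∀ k, i < k → c k ≠ 0 := by
      intro k hk h0
      have h1 := hsuf a i t List.suffix_rfl k hk
      have h2 : ((f i + (t.map Prod.snd).count k + k : ℕ) : ℂ) =
          ((f k + (t.map Prod.snd).count i + i : ℕ) : ℂ) := by
        rw [hc] at h0
        push_cast
        linear_combination h0
      have h3 := Nat.cast_injective h2
      rw [Fin.lt_def] at hk
      omega
    have hz : (zPairs ((a, i) :: t) : U m n) • v =
        (∏ k ∈ Finset.Ioi i, c k) • lowerEnd (actE L) a c i ((zPairs t : U m n) • v) := by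
      rw [← zLower_smul hsing a hc hc0, zPairs, List.map_cons, List.prod_cons, mul_smul]
      rfl
    rw [hz]
    refine ⟨?_, fun i₀ hi₀ ψ hker => ?_⟩
    · convert (hsing.lowerEnd he a hc hc0).smul _ using 2 with p
      rw [List.map_cons, List.count_cons]
      rcases eq_or_ne p i with rfl | h
      · simp [sub_sub]
      · simp [h, Ne.symm h]
    · have hi := hi₀ _ List.mem_cons_self
      -- The functional `ψ ∘ E_{ai}` still kills images of `E_{kl}`, but only for `l ≥ i`, where `k
      -- ≠ i`. This suffices because the remaining factors have index at least `i`.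
      obtain ⟨C, hC, h⟩ := hψ i hw.1 (ψ ∘ₗ actE L (.inr a : Idx m n) (.inl i))
        fun k l hl hlk y => by
          have := he.even_lower k l i a y
          rw [if_neg (hl.trans_lt hlk).ne', sub_zero] at this
          rw [LinearMap.comp_apply, ← this, hker k l (hi.trans hl) hlk]
      refine ⟨(∏ k ∈ Finset.Ioi i, c k) * C, mul_ne_zero (Finset.prod_ne_zero_iff.mpr fun k hk =>
        hc0 k (Finset.mem_Ioi.mp hk)) hC, ?_⟩
      rw [LinearMap.comp_apply, LinearMap.comp_apply] at h
      rw [lowerEnd_apply, map_smul, map_add, map_sum, Finset.sum_eq_zero fun k hk => ?_, add_zero,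
        h, smul_eq_mul, mul_assoc]
      · rfl
      · rw [map_smul, hker k i hi (Finset.mem_Ioi.mp hk), smul_zero]

/-- The pairs `(a, j)` in the order of the factors of `zProd`. -/
def blockPairs (n : ℕ) {m : ℕ} (d : Fin m → ℕ) : List (Fin n × Fin m) :=
  (List.ofFn fun j : Fin m =>
    (((List.finRange n).filter fun p : Fin n => p.val < d j).reverse).map fun p => (p, j)).flatten

theorem zProd_eq (lam : Idx m n → ℕ) (mu : Fin m → ℕ) :
    (zProd lam mu : U m n) = zPairs (blockPairs n fun j => lam (.inl j) - mu j) := by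
  rw [zPairs, blockPairs, List.map_flatten, List.prod_flatten, List.map_ofFn, List.map_ofFn, zProd]
  congr 2
  funext j
  simp [zBlock, Function.comp_def]

theorem mem_blockPairs {d : Fin m → ℕ} (x : Fin n × Fin m) :
    x ∈ blockPairs n d ↔ (x.1 : ℕ) < d x.2 := by
  obtain ⟨p, j⟩ := x
  simp only [blockPairs, List.mem_flatten, List.mem_ofFn]
  constructor
  · rintro ⟨_, ⟨j', rfl⟩, h⟩
    simp only [List.mem_map, List.mem_reverse, List.mem_filter, List.mem_finRange, true_and,
      decide_eq_true_eq, Prod.mk.injEq] at h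
    obtain ⟨p', h, rfl, rfl⟩ := h
    exact h
  · intro h
    exact ⟨_, ⟨j, rfl⟩, by simpa using h⟩

theorem blockPairs_pairwise (d : Fin m → ℕ) :
    (blockPairs n d).Pairwise fun x y => x.2 ≤ y.2 := by
  rw [blockPairs, List.pairwise_flatten]
  refine ⟨fun l hl => ?_, ?_⟩
  · obtain ⟨j, rfl⟩ := List.mem_ofFn.mp hl
    rw [List.pairwise_map]
    exact List.pairwise_of_forall fun _ _ => le_rfl
  · rw [List.pairwise_ofFn]
    intro i j hij x hx y hy
    obtain ⟨p, -, rfl⟩ := List.mem_map.mp hx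
    obtain ⟨q, -, rfl⟩ := List.mem_map.mp hy
    exact hij.le

theorem blockPairs_nodup (d : Fin m → ℕ) : (blockPairs n d).Nodup := by
  rw [blockPairs, List.nodup_flatten]
  refine ⟨fun l hl => ?_, ?_⟩
  · obtain ⟨j, rfl⟩ := List.mem_ofFn.mp hl
    exact (List.nodup_reverse.mpr ((List.nodup_finRange n).filter _)).map
      (Prod.mk_left_injective j)
  · rw [List.pairwise_ofFn]
    intro i j hij x hx hy
    obtain ⟨p, -, rfl⟩ := List.mem_map.mp hx
    obtain ⟨q, -, h⟩ := List.mem_map.mp hy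
    exact hij.ne (Prod.mk.inj h).2.symm

theorem blockPairs_count {d : Fin m → ℕ} (hd : ∀ j, d j ≤ n) (k : Fin m) :
    ((blockPairs n d).map Prod.snd).count k = d k := by
  have hlen : ((List.finRange n).filter fun p : Fin n => p.val < d k).length = d k := by
    rw [← List.toFinset_card_of_nodup ((List.nodup_finRange n).filter _), List.toFinset_filter,
      List.toFinset_finRange]
    simpa [Fin.card_filter_val_lt] using hd k
  rw [blockPairs, List.map_flatten, List.count_flatten, List.map_ofFn, List.map_ofFn,
    List.sum_ofFn, Finset.sum_eq_single k]
  · simp [Function.comp_def, hlen]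
  · intro j _ hj
    rw [Function.comp_apply, Function.comp_apply, List.count_eq_zero]
    simpa using fun _ _ => hj
  · simp

/-- The span of lowering monomials is stable under all generators, so it is a nonzero submodule of a
simple module. -/
theorem lowerSpan_eq_top {lam : Idx m n → ℂ} {v : L} (hL : IsIrredHighestWeight L lam v)
    (hv : HighestOn (actE L : Idx m n → _) Finset.univ lam v) :
    lowerSpan (actE L : Idx m n → _) Finset.univ v 0 = ⊤ := by
  have he := isRep_actE (m := m) (n := n) (L := L)
  have hstab : ∀ (u : U m n) (w : L), w ∈ lowerSpan (actE L : Idx m n → _) Finset.univ v 0 →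
      u • w ∈ lowerSpan (actE L : Idx m n → _) Finset.univ v 0 := by
    intro u
    obtain ⟨x, rfl⟩ := RingQuot.mkAlgHom_surjective ℂ (Rel m n) u
    induction x using FreeAlgebra.induction with
    | grade0 r =>
      intro w hw
      rw [AlgHom.commutes, algebraMap_smul]
      exact Submodule.smul_mem _ _ hw
    | grade1 x =>
      intro w hw
      exact lowerSpan_stable he hv hw (Finset.mem_univ x.1) (Finset.mem_univ x.2)
    | mul a b ha hb => intro w hw; rw [map_mul, mul_smul]; exact ha _ (hb _ hw)
    | add a b ha hb => intro w hw; rw [map_add, add_smul]; exact add_mem (ha _ hw) (hb _ hw)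
  have := hL.irreducible
  let D : Submodule (U m n) L :=
    { lowerSpan (actE L : Idx m n → _) Finset.univ v 0 with smul_mem' := fun u w => hstab u w }
  have hD : D = ⊤ := by
    refine (eq_bot_or_eq_top D).resolve_left fun h => hL.ne_zero ?_
    have : v ∈ D := self_mem_lowerSpan
    rwa [h, Submodule.mem_bot] at this
  refine eq_top_iff.mpr fun w _ => ?_
  have : w ∈ D := hD ▸ Submodule.mem_top
  exact this

end Module

end GLSuper

/-! ### The pairing argument. -/

theorem corollary4p3 (m n : ℕ) (lam : GLSuper.Idx m n → ℕ) (hlam : GLSuper.IsCovariant lam)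
    (L : Type*) [AddCommGroup L] [Module ℂ L] [Module (GLSuper.U m n) L]
    [IsScalarTower ℂ (GLSuper.U m n) L] (v : L)
    (hL : GLSuper.IsIrredHighestWeight L (fun i => (lam i : ℂ)) v)
    (mu : Fin m → ℕ) (hmu : Antitone mu)
    (hle : ∀ i : Fin m, mu i ≤ lam (Sum.inl i) ∧ lam (Sum.inl i) - mu i ≤ n) :
    GLSuper.zProd lam mu • v ∈ GLSuper.multiplicitySpace n L (fun i => (mu i : ℂ)) ∧
      GLSuper.zProd lam mu • v ≠ 0 := by
  open GLSuper in
  have he := isRep_actE (m := m) (n := n) (L := L)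
  have hv : HighestOn (actE L : Idx m n → _) Finset.univ (fun i => (lam i : ℂ)) v :=
    ⟨fun x _ y _ hxy => hL.raising x y ((toLex_lt_iff x y).mpr hxy), fun x _ => hL.weight x⟩
  have hsing : Sing (actE L : Idx m n → _) (fun p => ((lam (.inl p) : ℕ) : ℂ)) v :=
    ⟨fun p q h => hv.raising _ (Finset.mem_univ _) _ (Finset.mem_univ _) h,
      fun p => hv.weight _ (Finset.mem_univ _)⟩
  obtain ⟨w, hw⟩ : ∃ w, w = blockPairs n fun j => lam (.inl j) - mu j := ⟨_, rfl⟩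
  have hpw : w.Pairwise fun x y => x.2 ≤ y.2 := hw ▸ blockPairs_pairwise _
  have hcount : ∀ k, (w.map Prod.snd).count k = lam (.inl k) - mu k := fun k => by
    rw [hw, blockPairs_count fun j => (hle j).2]
  have hsuf : ∀ a i t, (a, i) :: t <:+ w → ∀ k, i < k →
      lam (.inl k) + (t.map Prod.snd).count i + 1 ≤ lam (.inl i) + (t.map Prod.snd).count k := by
    rintro a i t ⟨p, hp⟩ k hk
    have hi := hcount i
    have hk' := hcount k
    -- Pairs to the left of `(a, i)` have index at most `i`, so every occurrence of `k > i` lies in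
    -- `t`: entry `k` has already reached `mu k`, while entry `i` still exceeds `mu i`.
    have hpk : (p.map Prod.snd).count k = 0 := by
      rw [List.count_eq_zero]
      intro hmem
      obtain ⟨x, hx, rfl⟩ := List.mem_map.mp hmem
      rw [← hp, List.pairwise_append] at hpw
      exact (hpw.2.2 x hx _ List.mem_cons_self).not_gt hk
    rw [← hp, List.map_append, List.count_append, List.map_cons, List.count_cons] at hi hk'
    rw [if_neg (by simpa using hk.ne)] at hk'
    rw [if_pos (by simp)] at hi
    have h1 := hmu hk.le
    have h2 := (hle i).1
    have h3 := (hle k).1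
    omega
  obtain ⟨hs, hψ⟩ := zPairs_smul hsing hpw hsuf
  rw [zProd_eq, ← hw]
  refine ⟨⟨hs.raising, fun p => ?_⟩, fun h0 => ?_⟩
  · rw [← actE_apply, hs.weight, hcount, Nat.cast_sub (hle p).1, sub_sub_cancel]
  · obtain ⟨φ₀, hφ₀, hhigh⟩ := exists_dual_highest he hv rfl hL.ne_zero (lowerSpan_eq_top hL hv)
    obtain ⟨φ, hφ, -, w', hnd, hmem, C, hC, hR⟩ := exists_tower he.dual hhigh
      (fun i j h => hlam.anti_left i j h) hmu (fun i => (hle i).1) n le_rfl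
    have hker : ∀ k l : Fin m, l < k → ∀ y, φ (actE L (.inl k : Idx m n) (.inl l) y) = 0 :=
      fun k l h y => LinearMap.congr_fun (hφ.raising l k h) y
    have hperm : w.reverse.Perm w' := by
      rw [List.perm_ext_iff_of_nodup (List.nodup_reverse.mpr (hw ▸ blockPairs_nodup _)) hnd]
      intro x
      rw [List.mem_reverse, hw, mem_blockPairs, hmem]
      exact ⟨fun h => ⟨x.1.isLt, h⟩, fun h => h.2⟩
    have hne : φ (lowerPairs (actE L : Idx m n → _) w v) ≠ 0 := by
      have h1 : raisePairs (fun i j => (actE L j i : Module.End ℂ L).dualMap) w' φ v ≠ 0 := by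
        rw [hR, LinearMap.smul_apply, hφ₀, smul_eq_mul, mul_one]
        exact hC
      have h2 := raisePairs_dual (actE L : Idx m n → _) w.reverse φ v
      rw [List.reverse_reverse] at h2
      rw [← h2]
      rcases raisePairs_perm he.dual hperm φ with h | h <;> rw [h]
      · exact h1
      · rw [LinearMap.neg_apply]
        exact neg_ne_zero.mpr h1
    have hzero : ∃ C : ℂ, C ≠ 0 ∧ φ ((zPairs w : U m n) • v) =
        C * φ (lowerPairs (actE L) w v) := by
      -- The bound `i₀` is taken to be the least even index, which exists only for `m > 0`.
      rcases Nat.eq_zero_or_pos m with rfl | hm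
      · have : w = [] := List.eq_nil_iff_forall_not_mem.mpr fun x _ => x.2.elim0
        exact ⟨1, one_ne_zero, by simp [this, zPairs, lowerPairs]⟩
      · exact hψ ⟨0, hm⟩ (fun x _ => Fin.le_def.mpr (Nat.zero_le _)) φ fun k l _ h y => hker k l h y
    obtain ⟨C', hC', h⟩ := hzero
    rw [h0, map_zero] at h
    exact mul_ne_zero hC' hne h.symm
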